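/- Let $n\ge 1$, let $\mathbb Z_n=\{\zeta:\zeta^n=1\}$ act on $\mathbb C^n$ by scalar multiplication, and let $K=K_{\mathbb{CP}^{n-1}}$ be the total space of the canonical bundle $\mathcal O(-n)$ of $\mathbb{CP}^{n-1}$, with points $t\,z^{\otimes n}$ ($z\in\mathbb C^n\setminus 0$, $t\in\mathbb C$), exceptional divisor $E=\mathbb{CP}^{n-1}=\{t=0\}$ and blow-down map $\beta:K\to\mathbb C^n/\mathbb Z_n$, $t\,z^{\otimes n}\mapsto[t^{1/n}z]$. Off $E$ it is inverted by the map induced by $z\mapsto z^{\otimes n}$, and holomorphic coordinates on $K$ are $z_i^n$, $z_j/z_i$ ($j\ne i$). Put $U=|z_1|^2+\dots+|z_n|^2$ and $f'(U)=(1+U^{-n})^{1/n}$. There is a unique smooth real 2-form $\omega$ on $K$ (Calabi's Ricci-flat Kähler form) whose pull-back to $\mathbb C^n\setminus0$ is $\sqrt{-1}\,\bigl(f'(U)\,\partial\bar\partial U+f''(U)\,\partial U\wedge\bar\partial U\bigr)$, and a unique nowhere vanishing holomorphic $(n,0)$-form $\Omega$ on $K$ whose pull-back to $\mathbb C^n\setminus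 0$ is $dz_1\wedge\dots\wedge dz_n$. For a real $n$-plane $P\subset\mathbb C^n$ let $L_P\subset K$ be the strict transform of its image in $\mathbb C^n/\mathbb Z_n$, that is, the closure of $\beta^{-1}$ of the image of $P$ minus $[0]$; and let $\hat L_P$ be the strict transform of the image of $P\cup e^{i\pi/n}P$ (so $\hat L_P=L_P$ if $n$ is odd). An $n$-dimensional embedded submanifold $L\subset K$, possibly with boundary, is called Lagrangian if $\omega|_L=0$, and special Lagrangian of phase $\theta$ if moreover $\mathrm{Im}(e^{i\theta}\Omega)|_L=0$. (a) Let $A$ be a real symmetric $n\times n$ matrix, $P_A$ the plane $x=Ay$ in $\mathbb C^n$ ($z=x+iy$), $L_A=L_{P_A}$, $\hat L_A=\hat L_{P_A}$. Then $L_A$ is a smooth embedded submanifold of $K$, without boundary if $n$ is odd and with boundary $L_A\cap E$ if $n$ is even; $\hat L_A$ is a smooth embedded submanifold without boundary; and both are Lagrangian. For every $\theta\in\mathbb R$, $L_A$ is special Lagrangian of phase $\theta$ if and only if $$\sin\theta\sum_{n-|S|\ \mathrm{even}}(-1)^{\frac{n-|S|}2}\det A_S\;+\;\cos\theta\sum_{n-|S|\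 \mathrm{odd}}(-1)^{\frac{n-|S|-1}2}\det A_S\;=\;0,\qquad(*)$$ where $S$ runs over the subsets of $\{1,\dots,n\}$, $A_S$ is the submatrix of $A$ with rows and columns in $S$, and $\det A_\emptyset=1$. The same holds for $\hat L_A$. Exactly one $\theta\in[0,\pi)$ satisfies $(*)$. (b) Let $A_k$ ($k\in\mathbb N$) be real symmetric $n\times n$ matrices such that the planes $P_{A_k}$ converge, in the Grassmannian of real $n$-planes, to a real $n$-plane $Q$. Then there is $\theta\in[0,2\pi)$ such that $L_Q$ (with boundary $L_Q\cap E$ if $n$ is even, without boundary if $n$ is odd) and $\hat L_Q$ (without boundary) are smooth embedded special Lagrangian submanifolds of phase $\theta$. Moreover, if $\theta_k$ satisfies $(*)$ for $A_k$, for every $k$, and $\theta_k\to\theta$, then $L_Q$ and $\hat L_Q$ are special Lagrangian of phase $\theta$. -/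

import Mathlib

open scoped Manifold ContDiff Topology ComplexConjugate
open Set Filter

namespace CalabiModel

noncomputable section

/-- `ℂⁿ` with its Hermitian structure; it is also the model space of all manifolds below. -/
abbrev E (n : ℕ) : Type := EuclideanSpace ℂ (Fin n)

/-! ### The quotient `ℂⁿ / ℤ_n` -/

/-- The orbit relation of `ℤ_n = {ζ | ζ ^ n = 1}` acting on `ℂⁿ` by scalar multiplication. -/
def rotSetoid (n : ℕ) [NeZero n] : Setoid (E n) where
  r z z' := ∃ ζ : ℂ, ζ ^ n = 1 ∧ z' = ζ • z
  iseqv := by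
    refine ⟨fun z => ⟨1, by simp, by simp⟩, ?_, ?_⟩
    · rintro z z' ⟨ζ, h, rfl⟩
      have h0 : ζ ≠ 0 := by
        rintro rfl
        simp [NeZero.ne n] at h
      exact ⟨ζ⁻¹, by rw [inv_pow, h, inv_one], by rw [smul_smul, inv_mul_cancel₀ h0, one_smul]⟩
    · rintro z z' z'' ⟨ζ, h, rfl⟩ ⟨ξ, h', rfl⟩
      exact ⟨ξ * ζ, by rw [mul_pow, h, h', one_mul], by rw [smul_smul]⟩

/-- The orbifold `ℂⁿ / ℤ_n`. -/
def Orb (n : ℕ) [NeZero n] : Type := Quotient (rotSetoid n)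

/-- The projection `ℂⁿ → ℂⁿ / ℤ_n`. -/
def Orb.mk {n : ℕ} [NeZero n] (z : E n) : Orb n := Quotient.mk (rotSetoid n) z

/-! ### The total space of the canonical bundle `O(-n)` of `ℂP^{n-1}` -/

/-- Pairs `(z, t)` with `z ∈ ℂⁿ ∖ 0` and `t ∈ ℂ`. -/
abbrev PreK (n : ℕ) : Type := {p : E n × ℂ // p.1 ≠ 0}

/-- `(z, t) ∼ (l z, l⁻ⁿ t)` for `l ∈ ℂ^*`. -/
def kSetoid (n : ℕ) : Setoid (PreK n) where
  r p q := ∃ l : ℂ, l ≠ 0 ∧ q.1.1 = l • p.1.1 ∧ p.1.2 = l ^ n * q.1.2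
  iseqv := by
    refine ⟨fun p => ⟨1, one_ne_zero, by simp, by simp⟩, ?_, ?_⟩
    · rintro p q ⟨l, h, h1, h2⟩
      refine ⟨l⁻¹, inv_ne_zero h, ?_, ?_⟩
      · rw [h1, smul_smul, inv_mul_cancel₀ h, one_smul]
      · rw [h2, ← mul_assoc, ← mul_pow, inv_mul_cancel₀ h, one_pow, one_mul]
    · rintro p q r ⟨l, h, h1, h2⟩ ⟨m, h', h1', h2'⟩
      refine ⟨m * l, mul_ne_zero h' h, ?_, ?_⟩
      · rw [h1', h1, smul_smul]
      · rw [h2, h2', mul_pow]; ring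

/-- `K_{ℂP^{n-1}} = O(-n)`, the total space of the canonical line bundle of `ℂP^{n-1}`: the class
of `(z, t)` is the vector `t z^{⊗ n}` in the fibre over the line `[z]`. -/
def K (n : ℕ) : Type := Quotient (kSetoid n)

instance (n : ℕ) : TopologicalSpace (K n) :=
  inferInstanceAs (TopologicalSpace (Quotient (kSetoid n)))

/-- The point `t z^{⊗ n}` of the fibre over `[z]`. -/
def K.mk {n : ℕ} (p : PreK n) : K n := Quotient.mk (kSetoid n) p

theorem K.isQuotientMap_mk (n : ℕ) : Topology.IsQuotientMap (K.mk (n := n)) := isQuotientMap_quotient_mk'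

theorem K.mk_surjective (n : ℕ) : Function.Surjective (K.mk (n := n)) := Quotient.mk_surjective

theorem K.mk_eq_iff {n : ℕ} {p q : PreK n} :
    K.mk p = K.mk q ↔ ∃ l : ℂ, l ≠ 0 ∧ q.1.1 = l • p.1.1 ∧ p.1.2 = l ^ n * q.1.2 :=
  Quotient.eq (r := kSetoid n)

/-- The `i`-th blow-up coordinates on pairs: the `i`-th coordinate is `t zᵢⁿ`, the others are
`zⱼ / zᵢ`. (For `t = 1` this is `wᵢ = zᵢⁿ`, `wⱼ = zⱼ / zᵢ`.) -/
def preCoord {n : ℕ} (i : Fin n) (p : E n × ℂ) : E n :=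
  WithLp.toLp 2 fun j => if j = i then p.2 * p.1 i ^ n else p.1 j / p.1 i

theorem preCoord_congr {n : ℕ} (i : Fin n) (p q : PreK n) (h : kSetoid n p q) :
    preCoord i p.1 = preCoord i q.1 := by
  obtain ⟨l, hl, h1, h2⟩ := h
  ext j
  simp only [preCoord, h1, h2, PiLp.smul_apply, smul_eq_mul]
  split_ifs
  · ring
  · rw [mul_div_mul_left _ _ hl]

/-- The `i`-th blow-up coordinates as a function on `K`. -/
def coord {n : ℕ} (i : Fin n) : K n → E n :=
  Quotient.lift (fun p : PreK n => preCoord i p.1) (preCoord_congr i)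

@[simp] theorem coord_mk {n : ℕ} (i : Fin n) (p : PreK n) : coord i (K.mk p) = preCoord i p.1 := rfl

/-- The vector `w` with its `i`-th coordinate replaced by `1`. -/
def affVec {n : ℕ} (i : Fin n) (w : E n) : E n := WithLp.toLp 2 fun j => if j = i then 1 else w j

@[simp] theorem affVec_self {n : ℕ} (i : Fin n) (w : E n) : affVec i w i = 1 := by simp [affVec]

theorem affVec_ne_zero {n : ℕ} (i : Fin n) (w : E n) : affVec i w ≠ 0 := by
  intro h
  have := affVec_self i w
  rw [h] at this
  simp at this

/-- The inverse of the `i`-th coordinates. -/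
def coordInv {n : ℕ} (i : Fin n) (w : E n) : K n := K.mk ⟨(affVec i w, w i), affVec_ne_zero i w⟩

/-- The open set `zᵢ ≠ 0`. -/
def dom {n : ℕ} (i : Fin n) : Set (K n) := {x | ∃ p : PreK n, K.mk p = x ∧ p.1.1 i ≠ 0}

theorem mk_mem_dom {n : ℕ} {i : Fin n} {p : PreK n} : K.mk p ∈ dom i ↔ p.1.1 i ≠ 0 := by
  refine ⟨?_, fun h => ⟨p, rfl, h⟩⟩
  rintro ⟨q, hq, hi⟩
  obtain ⟨l, hl, h1, -⟩ := K.mk_eq_iff.1 hq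
  rw [h1]
  simpa using ⟨hl, hi⟩

theorem isOpen_dom {n : ℕ} (i : Fin n) : IsOpen (dom i) := by
  rw [← (K.isQuotientMap_mk n).isOpen_preimage]
  have : K.mk ⁻¹' dom i = {p : PreK n | p.1.1 i ≠ 0} := by
    ext p; exact mk_mem_dom
  rw [this]
  exact isOpen_ne_fun (by fun_prop) continuous_const

theorem coordInv_coord {n : ℕ} {i : Fin n} {x : K n} (hx : x ∈ dom i) :
    coordInv i (coord i x) = x := by
  obtain ⟨p, rfl, hp⟩ := hx
  refine K.mk_eq_iff.2 ⟨p.1.1 i, hp, ?_, ?_⟩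
  · ext j
    by_cases h : j = i
    · subst h; simp [affVec]
    · simp [affVec, preCoord, h, mul_div_cancel₀ _ hp]
  · simp [preCoord, mul_comm]

theorem coord_coordInv {n : ℕ} (i : Fin n) (w : E n) : coord i (coordInv i w) = w := by
  ext j
  by_cases h : j = i
  · subst h; simp [coordInv, preCoord]
  · simp [coordInv, preCoord, h, affVec]

/-- The `i`-th blow-up chart of `K`. -/
def chart {n : ℕ} (i : Fin n) : OpenPartialHomeomorph (K n) (E n) where
  toFun := coord i
  invFun := coordInv i
  source := dom i
  target := univ
  map_source' _ _ := mem_univ _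
  map_target' w _ := mk_mem_dom.2 (by simp)
  left_inv' _ hx := coordInv_coord hx
  right_inv' w _ := coord_coordInv i w
  open_source := isOpen_dom i
  open_target := isOpen_univ
  continuousOn_toFun := by
    rw [(K.isQuotientMap_mk n).continuousOn_isOpen_iff (isOpen_dom i)]
    have h : ∀ p : PreK n, p ∈ K.mk ⁻¹' dom i → p.1.1 i ≠ 0 := fun p hp => mk_mem_dom.1 hp
    refine (PiLp.continuous_toLp 2 _).comp_continuousOn (continuousOn_pi.2 fun j => ?_)
    by_cases hj : j = i
    · simp only [hj, if_true]
      exact Continuous.continuousOn (by fun_prop)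
    · simp only [hj, if_false]
      exact ContinuousOn.div (Continuous.continuousOn (by fun_prop))
        (Continuous.continuousOn (by fun_prop)) h
  continuousOn_invFun := by
    refine Continuous.continuousOn ((K.isQuotientMap_mk n).continuous.comp ?_)
    refine Continuous.subtype_mk (Continuous.prodMk ?_ (by fun_prop)) _
    refine (PiLp.continuous_toLp 2 _).comp (continuous_pi fun j => ?_)
    by_cases hj : j = i
    · simp only [hj, if_true]; exact continuous_const
    · simp only [hj, if_false]; fun_prop

theorem exists_mem_dom {n : ℕ} (x : K n) : ∃ i : Fin n, x ∈ dom i := by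
  obtain ⟨p, rfl⟩ := K.mk_surjective n x
  by_contra! h
  refine p.2 ?_
  ext i
  by_contra hi
  exact h i (mk_mem_dom.2 hi)

/-- `K` with the atlas of the `n` blow-up charts. -/
instance (n : ℕ) : ChartedSpace (E n) (K n) where
  atlas := range chart
  chartAt x := chart (exists_mem_dom x).choose
  mem_chart_source x := (exists_mem_dom x).choose_spec
  chart_mem_atlas _ := mem_range_self _

theorem contDiffOn_transition {n : ℕ} (𝕜 : Type*) [NontriviallyNormedField 𝕜] [NormedAlgebra 𝕜 ℂ]
    (m : WithTop ℕ∞) (i j : Fin n) :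
    ContDiffOn 𝕜 m (fun w : E n => coord j (coordInv i w)) {w | affVec i w j ≠ 0} := by
  have hc : ∀ k, ContDiff 𝕜 m (fun w : E n => affVec i w k) := by
    intro k
    by_cases h : k = i
    · simp only [affVec, h, if_true]; exact contDiff_const
    · simp only [affVec, h, if_false]; fun_prop
  refine (PiLp.contDiff_toLp (𝕜 := 𝕜) (p := 2)).comp_contDiffOn (contDiffOn_pi.2 fun k => ?_)
  change ContDiffOn 𝕜 m (fun w : E n => (coord j (coordInv i w)) k) _
  by_cases h : k = j
  · have : (fun w : E n => (coord j (coordInv i w)) k) = fun w => w i * affVec i w j ^ n := by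
      funext w; simp [coordInv, preCoord, h]
    rw [this]
    exact (ContDiff.mul (by fun_prop) ((hc j).pow n)).contDiffOn
  · have : (fun w : E n => (coord j (coordInv i w)) k) = fun w => affVec i w k / affVec i w j := by
      funext w; simp [coordInv, preCoord, h]
    rw [this]
    simp only [div_eq_mul_inv]
    exact (hc k).contDiffOn.mul ((hc j).contDiffOn.inv fun w hw => hw)

theorem isManifold_aux {n : ℕ} (𝕜 : Type*) [NontriviallyNormedField 𝕜] [NormedAlgebra 𝕜 ℂ]
    (m : WithTop ℕ∞) : IsManifold 𝓘(𝕜, E n) m (K n) := by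
  refine isManifold_of_contDiffOn _ _ _ ?_
  rintro _ _ ⟨i, rfl⟩ ⟨j, rfl⟩
  refine (contDiffOn_transition 𝕜 m i j).mono ?_
  rintro w hw
  simp only [modelWithCornersSelf_coe_symm, modelWithCornersSelf_coe, range_id, inter_univ,
    preimage_id, OpenPartialHomeomorph.trans_source, mem_inter_iff, mem_preimage] at hw
  exact mk_mem_dom.1 hw.2

/-- `K` is a complex manifold. -/
instance (n : ℕ) : IsManifold 𝓘(ℂ, E n) ω (K n) := isManifold_aux ℂ ω

/-- `K` is a smooth real manifold. -/
instance (n : ℕ) : IsManifold 𝓘(ℝ, E n) ∞ (K n) := isManifold_aux ℝ ∞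

/-- The exceptional divisor `ℂP^{n-1} ⊂ K`, the zero section. -/
def excDiv (n : ℕ) : Set (K n) := {x | ∃ p : PreK n, K.mk p = x ∧ p.1.2 = 0}

theorem cpow_root_pow (n : ℕ) [NeZero n] (t : ℂ) : (t ^ ((n : ℂ)⁻¹)) ^ n = t :=
  Complex.cpow_nat_inv_pow t (NeZero.ne n)

/-- The blow-down map `K → ℂⁿ / ℤ_n`, `t z^{⊗ n} ↦ [t^{1/n} z]`; any two `n`-th roots of `t` give
the same class. -/
def blowDown {n : ℕ} [NeZero n] : K n → Orb n :=
  Quotient.lift (fun p : PreK n => Orb.mk (p.1.2 ^ ((n : ℂ)⁻¹) • p.1.1)) (by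
    rintro ⟨⟨z, t⟩, hz⟩ ⟨⟨z', t'⟩, hz'⟩ ⟨l, hl, h1, h2⟩
    refine Quotient.sound (s := rotSetoid n) ?_
    dsimp only at h1 h2 ⊢
    have hr := cpow_root_pow n t
    have hr' := cpow_root_pow n t'
    generalize t ^ ((n : ℂ)⁻¹) = r at hr ⊢
    generalize t' ^ ((n : ℂ)⁻¹) = r' at hr' ⊢
    have hn : n ≠ 0 := NeZero.ne n
    by_cases h0 : r = 0
    · have ht : t = 0 := by rw [← hr, h0, zero_pow hn]
      have ht' : t' = 0 := by
        rw [ht] at h2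
        exact (mul_eq_zero.1 h2.symm).resolve_left (pow_ne_zero n hl)
      have h0' : r' = 0 := by
        rw [ht'] at hr'
        exact pow_eq_zero_iff hn |>.1 hr'
      exact ⟨1, one_pow n, by simp [h0, h0']⟩
    · refine ⟨r' * l / r, ?_, ?_⟩
      · rw [div_pow, mul_pow, hr, hr', mul_comm, ← h2, div_self]
        rw [← hr]; exact pow_ne_zero n h0
      · rw [h1, smul_smul, smul_smul, div_mul_cancel₀ _ h0])

/-- The lift `ℂⁿ ∖ 0 → K`, `z ↦ z^{⊗ n}`, of the projection `ℂⁿ → ℂⁿ / ℤ_n`. (The value at `0`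
is irrelevant.) -/
def lift {n : ℕ} [NeZero n] (z : E n) : K n := by
  classical exact
    if h : z ≠ 0 then K.mk ⟨(z, 1), h⟩ else K.mk ⟨(affVec 0 0, 0), affVec_ne_zero 0 0⟩

theorem blowDown_lift {n : ℕ} [NeZero n] {z : E n} (hz : z ≠ 0) :
    blowDown (lift z) = Orb.mk z := by
  have : lift z = K.mk ⟨(z, 1), hz⟩ := dif_pos hz
  rw [this]
  change Orb.mk ((1 : ℂ) ^ ((n : ℂ)⁻¹) • z) = Orb.mk z
  simp

/-! ### Differential forms on `K` -/

/-- The tangent space of `K` at any point is `E n`, through the preferred chart at that point.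
A field of real alternating `2`-forms on `K`. -/
abbrev TwoForm (n : ℕ) : Type := ∀ x : K n, (TangentSpace 𝓘(ℝ, E n) x) [⋀^Fin 2]→L[ℝ] ℝ

/-- A field of complex `n`-linear alternating forms, that is, an `(n,0)`-form on `K`. -/
abbrev TopForm (n : ℕ) : Type := ∀ x : K n, (TangentSpace 𝓘(ℂ, E n) x) [⋀^Fin n]→L[ℂ] ℂ

/-- The expression of a `2`-form in the `i`-th blow-up chart. -/
def TwoForm.inChart {n : ℕ} (η : TwoForm n) (i : Fin n) (w : E n) : (E n) [⋀^Fin 2]→L[ℝ] ℝ :=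
  (η ((chart i).symm w)).compContinuousLinearMap (mfderiv 𝓘(ℝ, E n) 𝓘(ℝ, E n) (chart i).symm w)

/-- The expression of an `(n,0)`-form in the `i`-th blow-up chart. -/
def TopForm.inChart {n : ℕ} (Φ : TopForm n) (i : Fin n) (w : E n) : (E n) [⋀^Fin n]→L[ℂ] ℂ :=
  (Φ ((chart i).symm w)).compContinuousLinearMap (mfderiv 𝓘(ℂ, E n) 𝓘(ℂ, E n) (chart i).symm w)

/-- The function `f'(U) = (1 + U⁻ⁿ)^{1/n}`. -/
def calabiDeriv (n : ℕ) (U : ℝ) : ℝ := (1 + 1 / U ^ n) ^ (1 / (n : ℝ))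

/-- The form `√-1 (f'(U) ∂∂̄U + f''(U) ∂U ∧ ∂̄U)` at `z`, where `U = |z₁|² + … + |zₙ|²`, so that
`∂∂̄U = ∑ dzⱼ ∧ dz̄ⱼ` and `∂U = ∑ z̄ⱼ dzⱼ`, evaluated at tangent vectors `X`, `Y`. -/
def calabiFlat {n : ℕ} (z X Y : E n) : ℂ :=
  let U : ℝ := ∑ j, ‖z j‖ ^ 2
  let dU : E n → ℂ := fun V => ∑ j, conj (z j) * V j
  Complex.I * ((calabiDeriv n U : ℂ) * (∑ j, (X j * conj (Y j) - Y j * conj (X j))) +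
    ((deriv (calabiDeriv n) U : ℝ) : ℂ) * (dU X * conj (dU Y) - dU Y * conj (dU X)))

/-- `η` is Calabi's Ricci-flat Kähler form on `K`: it is a smooth `2`-form on all of `K` whose
pull-back to `ℂⁿ ∖ 0` is `√-1 (f'(U) ∂∂̄U + f''(U) ∂U ∧ ∂̄U)`. -/
structure IsCalabiForm {n : ℕ} [NeZero n] (η : TwoForm n) : Prop where
  smooth : ∀ i, ContDiff ℝ ∞ (η.inChart i)
  pullback : ∀ z : E n, z ≠ 0 → ∀ X Y : E n,
    ((η (lift z) ![mfderiv 𝓘(ℝ, E n) 𝓘(ℝ, E n) lift z X,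
      mfderiv 𝓘(ℝ, E n) 𝓘(ℝ, E n) lift z Y] : ℝ) : ℂ) = calabiFlat z X Y

/-- `Φ` is the holomorphic volume form of `K`: it is a nowhere vanishing holomorphic `(n,0)`-form on
all of `K` whose pull-back to `ℂⁿ ∖ 0` is `dz₁ ∧ … ∧ dzₙ`. -/
structure IsVolumeForm {n : ℕ} [NeZero n] (Φ : TopForm n) : Prop where
  holomorphic : ∀ i, Differentiable ℂ (Φ.inChart i)
  ne_zero : ∀ x, Φ x ≠ 0
  pullback : ∀ z : E n, z ≠ 0 → ∀ X : Fin n → E n,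
    Φ (lift z) (fun k => mfderiv 𝓘(ℂ, E n) 𝓘(ℂ, E n) lift z (X k)) =
      (Matrix.of fun j k => X k j).det

/-! ### Submanifolds of `K` -/

/-- `S` is an embedded smooth submanifold of `K`, of real dimension `n`, with boundary `B`: near each
point of `S ∖ B` some smooth chart of `K` takes `S` to an `n`-dimensional real subspace `W`, and near
each point of `B` some smooth chart takes `S` to a half space of such a `W`, with the point on the
bounding hyperplane. -/
structure IsSubmanifold {n : ℕ} (S B : Set (K n)) : Prop where
  boundary_subset : B ⊆ S
  interior : ∀ x ∈ S, x ∉ B → ∃ φ ∈ IsManifold.maximalAtlas 𝓘(ℝ, E n) ∞ (K n), x ∈ φ.source ∧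
    ∃ W : Submodule ℝ (E n), Module.finrank ℝ W = n ∧ ∀ y ∈ φ.source, (y ∈ S ↔ φ y ∈ W)
  boundary : ∀ x ∈ B, ∃ φ ∈ IsManifold.maximalAtlas 𝓘(ℝ, E n) ∞ (K n), x ∈ φ.source ∧
    ∃ W : Submodule ℝ (E n), Module.finrank ℝ W = n ∧ ∃ l : E n →L[ℝ] ℝ, (∃ v ∈ W, l v ≠ 0) ∧
      l (φ x) = 0 ∧ ∀ y ∈ φ.source, (y ∈ S ↔ φ y ∈ W ∧ 0 ≤ l (φ y))

/-- The tangent space of `S` at `x`, inside the tangent space of `K` at `x`: the span of the tangent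
cone of `S` in the preferred chart at `x`. -/
def tangent {n : ℕ} (S : Set (K n)) (x : K n) : Submodule ℝ (TangentSpace 𝓘(ℝ, E n) x) :=
  Submodule.span ℝ
    (tangentConeAt ℝ (chartAt (E n) x '' (S ∩ (chartAt (E n) x).source)) (chartAt (E n) x x))

/-- `S` is an `n`-dimensional submanifold with boundary `B` to which `η` restricts to zero. -/
structure IsLagrangian {n : ℕ} (η : TwoForm n) (S B : Set (K n)) : Prop where
  submanifold : IsSubmanifold S B
  restrict : ∀ x ∈ S, ∀ X ∈ tangent S x, ∀ Y ∈ tangent S x, η x ![X, Y] = 0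

/-- `S` is Lagrangian for `η`, and `Im (e^{iθ} Φ)` restricts to zero on `S`. -/
structure IsSpecialLagrangian {n : ℕ} (η : TwoForm n) (Φ : TopForm n) (θ : ℝ) (S B : Set (K n)) :
    Prop where
  lagrangian : IsLagrangian η S B
  special : ∀ x ∈ S, ∀ X : Fin n → TangentSpace 𝓘(ℝ, E n) x, (∀ k, X k ∈ tangent S x) →
    (Complex.exp (θ * Complex.I) * Φ x X).im = 0

/-! ### Planes and their lifts -/

/-- The real plane `x = A y` in `ℂⁿ`, where `z = x + i y`. -/
def plane {n : ℕ} (A : Matrix (Fin n) (Fin n) ℝ) : Submodule ℝ (E n) where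
  carrier := {z | ∀ i, (z i).re = ∑ j, A i j * (z j).im}
  zero_mem' := by simp
  add_mem' := by
    intro a b ha hb i
    simp only [mem_ofPred_eq] at ha hb
    simp [ha i, hb i, mul_add, Finset.sum_add_distrib]
  smul_mem' := by
    intro c a ha i
    simp only [mem_ofPred_eq] at ha
    simp [ha i, Finset.mul_sum, mul_left_comm]

/-- The strict transform under the blow-down map `K → ℂⁿ / ℤ_n` of the image of `S ⊆ ℂⁿ`. -/
def strictTransform {n : ℕ} [NeZero n] (S : Set (E n)) : Set (K n) :=
  closure (blowDown ⁻¹' (Orb.mk '' S \ {Orb.mk 0}))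

/-- The lift `L_P` of a real plane `P` to `K`. -/
def lifted {n : ℕ} [NeZero n] (P : Submodule ℝ (E n)) : Set (K n) := strictTransform (P : Set (E n))

/-- The boundary of `L_P`: its intersection with the exceptional divisor for even `n`, and empty for
odd `n`. -/
def liftedBoundary {n : ℕ} [NeZero n] (P : Submodule ℝ (E n)) : Set (K n) :=
  {x | Even n ∧ x ∈ lifted P ∧ x ∈ excDiv n}

/-- The lift of `P ∪ e^{iπ/n} P`. It is `L_P` for odd `n`; for even `n` it continues `L_P` across the
exceptional divisor. -/
def doubled {n : ℕ} [NeZero n] (P : Submodule ℝ (E n)) : Set (K n) :=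
  strictTransform
    ((P : Set (E n)) ∪ (fun z => Complex.exp (Real.pi / n * Complex.I) • z) '' (P : Set (E n)))

/-- The principal minor of `A` with rows and columns in `S`. -/
def principalMinor {n : ℕ} (A : Matrix (Fin n) (Fin n) ℝ) (S : Finset (Fin n)) : ℝ :=
  (A.submatrix (fun i : S => (i : Fin n)) (fun i : S => (i : Fin n))).det

/-- With `k = |S|`, the combination
`sin θ ∑_{n-k even} (-1)^{(n-k)/2} det A_S + cos θ ∑_{n-k odd} (-1)^{(n-k-1)/2} det A_S`. -/
def phaseSum {n : ℕ} (A : Matrix (Fin n) (Fin n) ℝ) (θ : ℝ) : ℝ :=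
  Real.sin θ * (∑ S : Finset (Fin n) with Even (n - S.card),
      (-1) ^ ((n - S.card) / 2) * principalMinor A S) +
    Real.cos θ * (∑ S : Finset (Fin n) with Odd (n - S.card),
      (-1) ^ ((n - S.card - 1) / 2) * principalMinor A S)

/-- The planes `P k` tend to `Q` in the Grassmannian: the orthogonal projections converge. -/
def PlanesTendTo {n : ℕ} (P : ℕ → Submodule ℝ (E n)) (Q : Submodule ℝ (E n)) : Prop :=
  Tendsto (fun k => (P k).starProjection) atTop (𝓝 Q.starProjection)

end

end CalabiModel

open CalabiModel

/-! A real n-plane on which the Hermitian product takes real values is M(ℝⁿ) for a unitary M, since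
a real orthonormal basis of it is a unitary basis of ℂⁿ (`exists_unitary`). The plane x = Ay is of
this kind because A is symmetric, and the property passes to limits. A unitary M acts on K by t
z^{⊗n} ↦ t (Mz)^{⊗n}; this preserves ω and multiplies Ω by det M. So everything can be read off for
ℝⁿ, in the blow-up charts composed with M⁻¹ (`linChart`).

In those charts the strict transform of the plane P = M(ℝⁿ) is the set of t (My)^{⊗n} with y real
and t ≥ 0, and adding e^{iπ/n}P allows all real t. The second set is ℝⁿ in each chart. For even n
the first is the half space wᵢ ≥ 0 of ℝⁿ, bounded by E; for odd n the two sets coincide, as (y, t) ∼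
(-y, -t).

The forms are explicit in the i-th chart. Let ζ be w with wᵢ replaced by 1. Then Uⁿ = |wᵢ|²|ζ|²ⁿ, Ω
= n⁻¹ dw₁ ∧ … ∧ dwₙ, and ω = √-1 (a ∂∂̄ log|ζ|² + b |ζ|²ⁿ α ∧ ᾱ) with a = (1+Uⁿ)^{1/n}, b =
(1+Uⁿ)^{1/n-1}, α = dwᵢ/n + wᵢ ∂ log|ζ|². These are smooth across E and determined off E, which is
dense in the sense needed: gluing, uniqueness and equivariance follow by continuity
(`coordForm_transCoord`, `exists_kForm`, `KForm.ext_of_pullback`).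

All coefficients are real at real points, so ω vanishes on real vectors there and both lifts are
Lagrangian. Likewise Ω on the lifts is det M times a real number, so phase θ means Im(e^{iθ} det M)
= 0, which is also the condition of phase θ on P itself (`isPhase_iff`). For x = Ay the columns of A
+ √-1 form a basis, and expanding det(A + √-1) in principal minors gives (*). Limits are handled on
the planes, by projecting vectors of Q to the approximating planes. -/

namespace CalabiModel

noncomputable section

/-! ### Coordinate expressions of the lift and of linear maps -/

section Coordinates

variable {n : ℕ} (𝕜 : Type*) [NontriviallyNormedField 𝕜] [NormedAlgebra 𝕜 ℂ]

theorem contDiff_affVec (m : WithTop ℕ∞) (i : Fin n) : ContDiff 𝕜 m (affVec (n := n) i) := by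
  refine (PiLp.contDiff_toLp (𝕜 := 𝕜) (p := 2)).comp (contDiff_pi.2 fun k => ?_)
  by_cases h : k = i
  · simp only [h, if_true]; exact contDiff_const
  · simp only [h, if_false]; fun_prop

theorem contDiffAt_preCoord (m : WithTop ℕ∞) (i : Fin n) {p : E n × ℂ} (hp : p.1 i ≠ 0) :
    ContDiffAt 𝕜 m (preCoord i) p := by
  refine (PiLp.contDiff_toLp (𝕜 := 𝕜) (p := 2)).contDiffAt.comp p (contDiffAt_pi.2 fun k => ?_)
  have hc : ∀ k, ContDiff 𝕜 m (fun q : E n × ℂ => q.1 k) := fun k => by fun_prop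
  by_cases h : k = i
  · simp only [h, if_true]
    exact (contDiff_snd.mul ((hc i).pow n)).contDiffAt
  · simp only [h, if_false, div_eq_mul_inv]
    exact (hc k).contDiffAt.mul ((hc i).contDiffAt.inv hp)

/-- The lift `ℂⁿ ∖ 0 → K` in the `i`-th blow-up coordinates. -/
def liftCoord (i : Fin n) (z : E n) : E n := preCoord i (z, 1)

/-- The map `t z^{⊗ n} ↦ t (M z)^{⊗ n}` from the `i`-th to the `j`-th blow-up coordinates. -/
def transCoord (M : E n ≃L[ℂ] E n) (i j : Fin n) (w : E n) : E n :=
  preCoord j (M (affVec i w), w i)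

theorem contDiffAt_liftCoord (m : WithTop ℕ∞) (i : Fin n) {z : E n} (hz : z i ≠ 0) :
    ContDiffAt 𝕜 m (liftCoord i) z :=
  (contDiffAt_preCoord 𝕜 m i (p := (z, 1)) hz).comp z
    (contDiffAt_id.prodMk contDiffAt_const)

theorem contDiffAt_transCoord [IsScalarTower 𝕜 ℂ (E n)] (m : WithTop ℕ∞) (M : E n ≃L[ℂ] E n)
    (i j : Fin n) {w : E n} (hw : M (affVec i w) j ≠ 0) :
    ContDiffAt 𝕜 m (transCoord M i j) w := by
  refine (contDiffAt_preCoord 𝕜 m j (p := (M (affVec i w), w i)) hw).comp w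
    (ContDiffAt.prodMk ?_ ?_)
  · exact ((M : E n →L[ℂ] E n).restrictScalars 𝕜).contDiff.contDiffAt.comp w
      (contDiff_affVec 𝕜 m i).contDiffAt
  · exact ContDiff.contDiffAt (by fun_prop)

theorem liftCoord_self (i : Fin n) (z : E n) : liftCoord i z i = z i ^ n := by
  simp [liftCoord, preCoord]

theorem liftCoord_of_ne {i j : Fin n} (h : j ≠ i) (z : E n) : liftCoord i z j = z j / z i := by
  simp [liftCoord, preCoord, h]

theorem smul_affVec_liftCoord {i : Fin n} {z : E n} (hz : z i ≠ 0) :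
    z i • affVec i (liftCoord i z) = z := by
  ext j
  by_cases h : j = i
  · subst h; simp
  · simp [affVec, h, liftCoord_of_ne, mul_div_cancel₀ _ hz]

theorem affVec_liftCoord {i : Fin n} {z : E n} (hz : z i ≠ 0) :
    affVec i (liftCoord i z) = (z i)⁻¹ • z := by
  conv_rhs => rw [← smul_affVec_liftCoord hz]
  simp [smul_smul, hz]

/-- The pairs (Mζ, zᵢⁿ) and (Mz, 1) represent the same point of K, the scalar being zᵢ. -/
theorem transCoord_liftCoord (M : E n ≃L[ℂ] E n) {i j : Fin n} {z : E n} (hz : z i ≠ 0)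
    (hMz : M z ≠ 0) : transCoord M i j (liftCoord i z) = liftCoord j (M z) := by
  have h : M (affVec i (liftCoord i z)) ≠ 0 := by simpa using affVec_ne_zero i _
  refine preCoord_congr j ⟨(_, _), h⟩ ⟨(M z, 1), hMz⟩ ⟨z i, hz, ?_, ?_⟩
  · dsimp only
    rw [← map_smul, smul_affVec_liftCoord hz]
  · simp [liftCoord_self]

/-- An n-th root r of wᵢ supplies the preimage rζ. Thus the lift reaches every point off the
exceptional divisor. -/
theorem exists_liftCoord_eq (hn : n ≠ 0) {i : Fin n} {w : E n} (hw : w i ≠ 0) :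
    ∃ z : E n, z i ≠ 0 ∧ liftCoord i z = w := by
  have hr := Complex.cpow_nat_inv_pow (w i) hn
  generalize w i ^ ((n : ℂ)⁻¹) = r at hr
  have hr0 : r ≠ 0 := by
    rintro rfl
    simp [hn] at hr
    exact hw hr.symm
  refine ⟨r • affVec i w, by simpa using hr0, ?_⟩
  ext j
  by_cases h : j = i
  · subst h; simp [liftCoord_self, hr]
  · rw [liftCoord_of_ne h]
    simp [affVec, h, hr0]

theorem fderiv_apply_coord {f : E n → E n} {z : E n} (hf : DifferentiableAt 𝕜 f z) (X : E n)
    (j : Fin n) : fderiv 𝕜 f z X j = fderiv 𝕜 (fun z => f z j) z X := by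
  have h : HasFDerivAt (fun z => f z j)
      ((PiLp.proj 2 (fun _ : Fin n => ℂ) j : E n →L[𝕜] ℂ) ∘L fderiv 𝕜 f z) z :=
    (PiLp.proj 2 (fun _ : Fin n => ℂ) j : E n →L[𝕜] ℂ).hasFDerivAt.comp z hf.hasFDerivAt
  rw [h.fderiv]
  rfl

theorem fderiv_liftCoord_self {i : Fin n} {z : E n} (hz : z i ≠ 0) (X : E n) :
    fderiv 𝕜 (liftCoord i) z X i = n * z i ^ (n - 1) * X i := by
  rw [fderiv_apply_coord 𝕜 ((contDiffAt_liftCoord 𝕜 1 i hz).differentiableAt one_ne_zero)]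
  have h : HasFDerivAt (fun z : E n => z i) (PiLp.proj 2 (fun _ : Fin n => ℂ) i : E n →L[𝕜] ℂ) z :=
    (PiLp.proj 2 (fun _ : Fin n => ℂ) i : E n →L[𝕜] ℂ).hasFDerivAt
  have h2 := h.pow n
  simp only [liftCoord_self]
  rw [h2.fderiv]
  simp

theorem fderiv_liftCoord_of_ne {i j : Fin n} (hj : j ≠ i) {z : E n} (hz : z i ≠ 0) (X : E n) :
    fderiv 𝕜 (liftCoord i) z X j = (z i)⁻¹ * X j + -(X i / z i ^ 2) * z j := by
  rw [fderiv_apply_coord 𝕜 ((contDiffAt_liftCoord 𝕜 1 i hz).differentiableAt one_ne_zero)]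
  have h : ∀ k, HasFDerivAt (fun z : E n => z k)
      (PiLp.proj 2 (fun _ : Fin n => ℂ) k : E n →L[𝕜] ℂ) z := fun k =>
    (PiLp.proj 2 (fun _ : Fin n => ℂ) k : E n →L[𝕜] ℂ).hasFDerivAt
  have h2 := (h j).mul ((hasFDerivAt_inv' hz).comp z (h i))
  simp only [liftCoord_of_ne hj, div_eq_mul_inv]
  erw [h2.fderiv]
  simp
  field_simp
  ring

/-- Away from zᵢ = 0 the lift is a local biholomorphism, so its pull-back determines a form. The
preimage solves the i-th equation first, then the others. -/
theorem fderiv_liftCoord_surjective (hn : n ≠ 0) {i : Fin n} {z : E n} (hz : z i ≠ 0) :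
    Function.Surjective (fderiv 𝕜 (liftCoord i) z) := by
  intro Y
  have hn' : (n : ℂ) ≠ 0 := by exact_mod_cast hn
  set a : ℂ := Y i / (n * z i ^ (n - 1))
  refine ⟨WithLp.toLp 2 fun j => if j = i then a else z i * Y j + z j * a / z i, ?_⟩
  ext j
  by_cases h : j = i
  · subst h
    rw [fderiv_liftCoord_self 𝕜 hz]
    simp only [if_true, a]
    field_simp
  · rw [fderiv_liftCoord_of_ne 𝕜 h hz]
    simp only [h, if_false, if_true]
    field_simp
    ring

theorem dense_coord_ne_zero (i : Fin n) : Dense {w : E n | w i ≠ 0} := by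
  have h : Dense {c : ℂ | c ≠ 0} := dense_compl_singleton 0
  exact h.preimage (f := fun w : E n => w i) (by
    have := (EuclideanSpace.proj (𝕜 := ℂ) i : E n →L[ℂ] ℂ).isOpenMap
      fun c => ⟨EuclideanSpace.single i c, by simp⟩
    exact this)

end Coordinates

/-! ### Forms on `K` and their coordinate expressions -/

section Forms

variable {n r : ℕ} {𝕜 : Type*} [NontriviallyNormedField 𝕜] [NormedAlgebra 𝕜 ℂ]

/-- A family of forms in coordinates that pulls back to `σ` on `ℂⁿ ∖ 0` is equivariant under the
linear maps under which `σ` is. -/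
theorem coordForm_transCoord [IsScalarTower 𝕜 ℂ (E n)] (hn : n ≠ 0)
    {c : Fin n → E n → (E n) [⋀^Fin r]→L[𝕜] 𝕜}
    (hc : ∀ i, Continuous (c i)) {σ : E n → (Fin r → E n) → 𝕜}
    (hσ : ∀ i z, z i ≠ 0 → ∀ X : Fin r → E n,
      c i (liftCoord i z) (fun k => fderiv 𝕜 (liftCoord i) z (X k)) = σ z X)
    (M : E n ≃L[ℂ] E n) (a : 𝕜)
    (hM : ∀ z, z ≠ 0 → ∀ X : Fin r → E n, σ (M z) (fun k => M (X k)) = a * σ z X)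
    (i j : Fin n) {w : E n} (hw : M (affVec i w) j ≠ 0) (X : Fin r → E n) :
    c j (transCoord M i j w) (fun k => fderiv 𝕜 (transCoord M i j) w (X k)) = a * c i w X := by
  have hev : ∀ᶠ w' in 𝓝 w, M (affVec i w') j ≠ 0 := by
    refine ContinuousAt.eventually_ne ?_ hw
    have h1 : Continuous (affVec (n := n) i) := (contDiff_affVec ℂ 0 i).continuous
    have h2 : Continuous fun v : E n => v j := by fun_prop
    exact (h2.comp (M.continuous.comp h1)).continuousAt
  have hT := contDiffAt_transCoord 𝕜 ω M i j hw
  have h1 : ContinuousAt (fun w' => c j (transCoord M i j w')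
      (fun k => fderiv 𝕜 (transCoord M i j) w' (X k))) w := by
    have hcT : ContinuousAt (fun w' => c j (transCoord M i j w')) w :=
      (hc j).continuousAt.comp hT.continuousAt
    refine hcT.eval (continuousAt_pi.2 fun k => ?_)
    exact (((hT.of_le le_top).fderiv_right (m := 0) (n := 1) (by simp)).continuousAt).clm_apply
      continuousAt_const
  have h2 : ContinuousAt (fun w' => a * c i w' X) w :=
    continuousAt_const.mul ((hc i).continuousAt.eval_const X)
  -- Both sides are continuous in w, so it suffices to compare them where wᵢ ≠ 0. There w is the
  -- lift of some z, and the claim reduces to the hypothesis on σ.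
  refine tendsto_nhds_unique_of_frequently_eq h1 h2 ?_
  have hd := mem_closure_iff_frequently.1 (dense_coord_ne_zero i w)
  refine (hd.and_eventually hev).mono fun w' hw' => ?_
  obtain ⟨z, hz, rfl⟩ := exists_liftCoord_eq hn hw'.1
  have hz0 : z ≠ 0 := by rintro rfl; simp at hz
  have hMz : M z j ≠ 0 := by
    have := hw'.2
    rw [affVec_liftCoord hz] at this
    simpa [hz] using this
  have hMz0 : M z ≠ 0 := by simpa using hz0
  choose Y hY using fun k => fderiv_liftCoord_surjective 𝕜 hn hz (X k)
  have hTz := (contDiffAt_transCoord 𝕜 1 M i j hw'.2).differentiableAt one_ne_zero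
  have hgz := (contDiffAt_liftCoord 𝕜 1 i hz).differentiableAt one_ne_zero
  have hgM := (contDiffAt_liftCoord 𝕜 1 j hMz).differentiableAt one_ne_zero
  let M' : E n →L[𝕜] E n := (M : E n →L[ℂ] E n).restrictScalars 𝕜
  have e1 : HasFDerivAt (liftCoord j ∘ M') (fderiv 𝕜 (liftCoord j) (M z) ∘L M') z :=
    hgM.hasFDerivAt.comp z M'.hasFDerivAt
  have e2 : HasFDerivAt (transCoord M i j ∘ liftCoord i)
      (fderiv 𝕜 (transCoord M i j) (liftCoord i z) ∘L fderiv 𝕜 (liftCoord i) z) z :=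
    hTz.hasFDerivAt.comp z hgz.hasFDerivAt
  have hzev : ∀ᶠ z' : E n in 𝓝 z, z' i ≠ 0 := by
    refine ContinuousAt.eventually_ne ?_ hz
    have h2 : Continuous fun v : E n => v i := by fun_prop
    exact h2.continuousAt
  -- The lift intertwines M with its action on K; differentiating this by the chain rule moves the
  -- vectors X k to the images of M (Y k).
  have e3 : transCoord M i j ∘ liftCoord i =ᶠ[𝓝 z] liftCoord j ∘ M' := by
    filter_upwards [hzev] with z' hz'
    refine transCoord_liftCoord M hz' ?_
    rw [Ne, map_eq_zero_iff _ M.injective]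
    rintro rfl
    simp at hz'
  have e4 := (e1.congr_of_eventuallyEq e3).unique e2
  have e5 : (fun k => fderiv 𝕜 (transCoord M i j) (liftCoord i z) (X k)) =
      fun k => fderiv 𝕜 (liftCoord j) (M z) (M (Y k)) := by
    funext k
    rw [← hY k]
    exact (DFunLike.congr_fun e4 (Y k)).symm
  have e6 : X = fun k => fderiv 𝕜 (liftCoord i) z (Y k) := funext fun k => (hY k).symm
  rw [e5, transCoord_liftCoord M hz hMz0, hσ j _ hMz (fun k => M (Y k)), hM z hz0, ← hσ i z hz Y,
    ← e6]

/-- The index of the preferred chart at `x`. -/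
def chartIdx (x : K n) : Fin n := (exists_mem_dom x).choose

theorem mem_dom_chartIdx (x : K n) : x ∈ dom (chartIdx x) := (exists_mem_dom x).choose_spec

theorem affVec_apply_ne_zero_iff {i j : Fin n} {w : E n} :
    affVec i w j ≠ 0 ↔ coordInv i w ∈ dom j :=
  (mk_mem_dom (p := ⟨(affVec i w, w i), affVec_ne_zero i w⟩)).symm

variable (𝕜) in
theorem mdifferentiableAt_chart_symm (i : Fin n) (w : E n) :
    MDifferentiableAt 𝓘(𝕜, E n) 𝓘(𝕜, E n) (chart i).symm w := by
  have : IsManifold 𝓘(𝕜, E n) 1 (K n) := isManifold_aux 𝕜 1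
  exact mdifferentiableAt_atlas_symm (mem_range_self i) (mem_univ _)

variable (𝕜) in
-- Tangent spaces of K are identified with `E n` through the preferred chart, so the derivative of
-- an inverse chart is that of the transition to the preferred chart.
theorem mfderiv_chart_symm (i : Fin n) (w : E n) :
    (mfderiv 𝓘(𝕜, E n) 𝓘(𝕜, E n) (chart i).symm w : E n →L[𝕜] E n) =
      fderiv 𝕜 (transCoord (.refl ℂ _) i (chartIdx (coordInv i w))) w := by
  rw [(mdifferentiableAt_chart_symm 𝕜 i w).mfderiv]
  simp only [modelWithCornersSelf_coe, range_id, fderivWithin_univ]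
  rfl

/-- A field of alternating forms on `K`, complex or real. -/
abbrev KForm (𝕜 : Type*) [NontriviallyNormedField 𝕜] [NormedAlgebra 𝕜 ℂ] (n r : ℕ) : Type _ :=
  ∀ x : K n, (TangentSpace 𝓘(𝕜, E n) x) [⋀^Fin r]→L[𝕜] 𝕜

/-- The expression of a form in the `i`-th blow-up chart. -/
def KForm.inChart (η : KForm 𝕜 n r) (i : Fin n) (w : E n) : (E n) [⋀^Fin r]→L[𝕜] 𝕜 :=
  (η ((chart i).symm w)).compContinuousLinearMap (mfderiv 𝓘(𝕜, E n) 𝓘(𝕜, E n) (chart i).symm w)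

/-- The value of a form at a point, on the model space of the tangent space. -/
def KForm.val (η : KForm 𝕜 n r) (x : K n) : (E n) [⋀^Fin r]→L[𝕜] 𝕜 := η x

theorem KForm.inChart_apply (η : KForm 𝕜 n r) (i : Fin n) (w : E n) (X : Fin r → E n) :
    η.inChart i w X = η.val (coordInv i w)
      (fun k => fderiv 𝕜 (transCoord (.refl ℂ _) i (chartIdx (coordInv i w))) w (X k)) := by
  rw [← mfderiv_chart_symm]
  rfl

/-- In the preferred chart at x the transition map is the identity, hence nothing is transformed. -/
theorem KForm.val_eq_inChart (η : KForm 𝕜 n r) (x : K n) :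
    η.val x = η.inChart (chartIdx x) (coord (chartIdx x) x) := by
  have hx := coordInv_coord (mem_dom_chartIdx x)
  ext X
  rw [KForm.inChart_apply, hx]
  have : transCoord (.refl ℂ _) (chartIdx x) (chartIdx x) = (id : E n → E n) :=
    funext fun w => coord_coordInv (chartIdx x) w
  simp [this]

theorem KForm.val_mfderiv_congr (η : KForm 𝕜 n r) {f g : E n → K n} {z : E n} (h : f =ᶠ[𝓝 z] g)
    (X : Fin r → E n) :
    η.val (f z) (fun k => mfderiv 𝓘(𝕜, E n) 𝓘(𝕜, E n) f z (X k)) =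
      η.val (g z) (fun k => mfderiv 𝓘(𝕜, E n) 𝓘(𝕜, E n) g z (X k)) := by
  have h1 : (mfderiv 𝓘(𝕜, E n) 𝓘(𝕜, E n) f z : E n →L[𝕜] E n) =
    mfderiv 𝓘(𝕜, E n) 𝓘(𝕜, E n) g z := h.mfderiv_eq
  have h2 : ∀ k, (mfderiv 𝓘(𝕜, E n) 𝓘(𝕜, E n) f z (X k) : E n) =
    mfderiv 𝓘(𝕜, E n) 𝓘(𝕜, E n) g z (X k) := fun k => DFunLike.congr_fun h1 (X k)
  rw [h.eq_of_nhds]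
  exact congrArg _ (funext h2)

theorem exists_coord_ne_zero {z : E n} (hz : z ≠ 0) : ∃ i, z i ≠ 0 := by
  by_contra! h
  exact hz (by ext i; exact h i)

/-! ### Forms on K determined and constructed through the lift -/

section Lift

variable [NeZero n]

theorem lift_of_ne {z : E n} (hz : z ≠ 0) : lift z = K.mk ⟨(z, 1), hz⟩ := dif_pos hz

theorem lift_eq_coordInv {i : Fin n} {z : E n} (hz : z i ≠ 0) :
    lift z = coordInv i (liftCoord i z) := by
  have h0 : z ≠ 0 := by rintro rfl; simp at hz
  rw [lift_of_ne h0]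
  exact (coordInv_coord (i := i) (mk_mem_dom.2 hz)).symm

theorem KForm.lift_apply (η : KForm 𝕜 n r) {i : Fin n} {z : E n} (hz : z i ≠ 0)
    (X : Fin r → E n) :
    η (lift z) (fun k => mfderiv 𝓘(𝕜, E n) 𝓘(𝕜, E n) lift z (X k)) =
      η.inChart i (liftCoord i z) (fun k => fderiv 𝕜 (liftCoord i) z (X k)) := by
  have hzev : ∀ᶠ z' : E n in 𝓝 z, z' i ≠ 0 := by
    refine ContinuousAt.eventually_ne ?_ hz
    have h2 : Continuous fun v : E n => v i := by fun_prop
    exact h2.continuousAt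
  have h : lift =ᶠ[𝓝 z] (chart i).symm ∘ liftCoord i := by
    filter_upwards [hzev] with z' hz' using lift_eq_coordInv hz'
  refine (KForm.val_mfderiv_congr η h X).trans ?_
  have hg := (contDiffAt_liftCoord 𝕜 1 i hz).differentiableAt one_ne_zero
  have h3 : mfderiv 𝓘(𝕜, E n) 𝓘(𝕜, E n) ((chart i).symm ∘ liftCoord i) z =
      (mfderiv 𝓘(𝕜, E n) 𝓘(𝕜, E n) (chart i).symm (liftCoord i z)).comp
        (fderiv 𝕜 (liftCoord i) z) := by
    rw [mfderiv_comp z (mdifferentiableAt_chart_symm 𝕜 i _) hg.mdifferentiableAt,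
      mfderiv_eq_fderiv]
    rfl
  rw [h3]
  rfl

/-- The pull-backs determine the coordinate expressions where wᵢ ≠ 0, because the derivative of the
lift is onto; density and continuity do the rest. -/
theorem KForm.ext_of_pullback {η η' : KForm 𝕜 n r} (hη : ∀ i, Continuous (η.inChart i))
    (hη' : ∀ i, Continuous (η'.inChart i))
    (h : ∀ z : E n, z ≠ 0 → ∀ X : Fin r → E n,
      η (lift z) (fun k => mfderiv 𝓘(𝕜, E n) 𝓘(𝕜, E n) lift z (X k)) =
        η' (lift z) (fun k => mfderiv 𝓘(𝕜, E n) 𝓘(𝕜, E n) lift z (X k))) : η = η' := by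
  have key : ∀ i, η.inChart i = η'.inChart i := by
    intro i
    refine Continuous.ext_on (dense_coord_ne_zero i) (hη i) (hη' i) fun w hw => ?_
    obtain ⟨z, hz, rfl⟩ := exists_liftCoord_eq (NeZero.ne n) hw
    ext Y
    choose X hX using fun k => fderiv_liftCoord_surjective 𝕜 (NeZero.ne n) hz (Y k)
    have hz0 : z ≠ 0 := by rintro rfl; simp at hz
    obtain rfl := funext hX
    rw [← KForm.lift_apply η hz, ← KForm.lift_apply η' hz, h z hz0]
  funext x
  change η.val x = η'.val x
  rw [KForm.val_eq_inChart, KForm.val_eq_inChart, key]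

/-- Gluing: the local expressions agree under chart changes by `coordForm_transCoord` with M = 1 and
a = 1, so reading each point in its preferred chart defines a form with all the given expressions.
-/
theorem exists_kForm [IsScalarTower 𝕜 ℂ (E n)] {c : Fin n → E n → (E n) [⋀^Fin r]→L[𝕜] 𝕜}
    (hc : ∀ i, Continuous (c i)) {σ : E n → (Fin r → E n) → 𝕜}
    (hσ : ∀ i z, z i ≠ 0 → ∀ X : Fin r → E n,
      c i (liftCoord i z) (fun k => fderiv 𝕜 (liftCoord i) z (X k)) = σ z X) :
    ∃ η : KForm 𝕜 n r, (∀ i, η.inChart i = c i) ∧ ∀ z : E n, z ≠ 0 → ∀ X : Fin r → E n,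
      η (lift z) (fun k => mfderiv 𝓘(𝕜, E n) 𝓘(𝕜, E n) lift z (X k)) = σ z X := by
  let η : KForm 𝕜 n r := fun x => c (chartIdx x) (coord (chartIdx x) x)
  have h1 : ∀ i, η.inChart i = c i := by
    intro i
    funext w
    ext X
    rw [KForm.inChart_apply]
    have := coordForm_transCoord (NeZero.ne n) hc hσ (.refl ℂ (E n)) 1 (by simp) i
      (chartIdx (coordInv i w)) (w := w)
      (affVec_apply_ne_zero_iff.2 (mem_dom_chartIdx _)) X
    rw [one_mul] at this
    exact this
  refine ⟨η, h1, fun z hz X => ?_⟩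
  obtain ⟨i, hi⟩ := exists_coord_ne_zero hz
  rw [KForm.lift_apply η hi, h1, hσ i z hi]

end Lift

end Forms

/-! ### The holomorphic volume form -/

section Volume

variable {n : ℕ}

/-- The form `dw₁ ∧ … ∧ dwₙ` on `ℂⁿ`. -/
def detForm (n : ℕ) : (E n) [⋀^Fin n]→L[ℂ] ℂ where
  toMultilinearMap := (Matrix.detRowAlternating (R := ℂ) (n := Fin n)).toMultilinearMap.compLinearMap
    fun _ => (WithLp.linearEquiv 2 ℂ (Fin n → ℂ)).toLinearMap
  cont := by
    change Continuous fun X : Fin n → E n => Matrix.det fun k => (X k).ofLp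
    refine Continuous.matrix_det ?_
    fun_prop
  map_eq_zero_of_eq' X k l h hkl := by
    change Matrix.det (fun k => (X k).ofLp) = 0
    exact Matrix.det_zero_of_row_eq hkl (congrArg _ h)

theorem detForm_apply (X : Fin n → E n) : detForm n X = (Matrix.of fun j k => X k j).det := by
  rw [← Matrix.det_transpose]
  rfl

theorem detForm_map (M : E n →ₗ[ℂ] E n) (X : Fin n → E n) :
    detForm n (fun k => M (X k)) = LinearMap.det M * detForm n X := by
  have h : ∀ Y : Fin n → E n, detForm n Y = (EuclideanSpace.basisFun (Fin n) ℂ).toBasis.det Y := by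
    intro Y
    rw [detForm_apply, Module.Basis.det_apply]
    rfl
  rw [h, h]
  exact Module.Basis.det_comp _ M X

/-- This Jacobian is the source of the factor n⁻¹ in the coordinate expression of Ω: one row is
scaled by n zᵢⁿ⁻¹, and n - 1 rows by zᵢ⁻¹. -/
theorem detForm_liftCoord {i : Fin n} {z : E n} (hz : z i ≠ 0) (X : Fin n → E n) :
    detForm n (fun k => fderiv ℂ (liftCoord i) z (X k)) = n * detForm n X := by
  rw [detForm_apply, detForm_apply]
  let c : Fin n → ℂ := fun j => if j = i then 0 else -(z j / z i)
  let v : Fin n → ℂ := fun j => if j = i then n * z i ^ (n - 1) else (z i)⁻¹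
  let B : Matrix (Fin n) (Fin n) ℂ := Matrix.of fun j k => X k j + c j * X k i
  -- For j ≠ i the j-th row of the derivative is zᵢ⁻¹ (Xⱼ - (zⱼ/zᵢ) Xᵢ); subtracting multiples of
  -- row i leaves the determinant unchanged.
  have h1 : B.det = (Matrix.of fun j k => X k j).det :=
    Matrix.det_eq_of_forall_row_eq_smul_add_const c i (by simp [c]) fun j k => by simp [B]
  have h2 : (Matrix.of fun j k => fderiv ℂ (liftCoord i) z (X k) j) =
      Matrix.of fun j k => v j * B j k := by
    ext j k
    by_cases h : j = i
    · subst h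
      simp [fderiv_liftCoord_self ℂ hz, v, B, c]
    · simp [fderiv_liftCoord_of_ne ℂ h hz, v, B, c, h]
      field_simp
  have h3 : ∏ j, v j = n := by
    rw [Fintype.prod_eq_mul_prod_compl i]
    have : ∏ j ∈ ({i} : Finset (Fin n))ᶜ, v j = (z i)⁻¹ ^ (n - 1) := by
      rw [Finset.prod_congr rfl (g := fun _ => (z i)⁻¹)]
      · simp [Finset.card_compl]
      · intro j hj
        have : j ≠ i := by simpa using hj
        simp [v, this]
    rw [this]
    simp only [v, if_true]
    rw [mul_assoc, ← mul_pow, mul_inv_cancel₀ hz, one_pow, mul_one]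
  rw [h2, Matrix.det_mul_column, h3, h1]

theorem volumeCoord_liftCoord (hn : n ≠ 0) {i : Fin n} {z : E n} (hz : z i ≠ 0)
    (X : Fin n → E n) :
    ((n : ℂ)⁻¹ • detForm n) (fun k => fderiv ℂ (liftCoord i) z (X k)) = detForm n X := by
  have hn' : (n : ℂ) ≠ 0 := by exact_mod_cast hn
  rw [ContinuousAlternatingMap.smul_apply, detForm_liftCoord hz, smul_eq_mul,
    inv_mul_cancel_left₀ hn']

variable [NeZero n]

theorem isVolumeForm_inChart {Φ : TopForm n} (hΦ : IsVolumeForm Φ) (i : Fin n) :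
    KForm.inChart (𝕜 := ℂ) Φ i = fun _ => (n : ℂ)⁻¹ • detForm n := by
  obtain ⟨Ψ, h1, h2⟩ := exists_kForm (n := n) (𝕜 := ℂ) (c := fun _ _ => (n : ℂ)⁻¹ • detForm n)
    (fun _ => continuous_const) (σ := fun _ X => detForm n X)
    fun i z hz X => volumeCoord_liftCoord (NeZero.ne n) hz X
  have : Φ = Ψ := by
    refine KForm.ext_of_pullback (𝕜 := ℂ) (fun i => (hΦ.holomorphic i).continuous) (fun i => ?_)
      fun z hz X => ?_
    · rw [h1]; exact continuous_const
    · rw [h2 z hz, detForm_apply]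
      exact hΦ.pullback z hz X
  rw [this, h1]

theorem existsUnique_isVolumeForm (n : ℕ) [NeZero n] : ∃! Φ : TopForm n, IsVolumeForm Φ := by
  obtain ⟨Ψ, h1, h2⟩ := exists_kForm (n := n) (𝕜 := ℂ) (c := fun _ _ => (n : ℂ)⁻¹ • detForm n)
    (fun _ => continuous_const) (σ := fun _ X => detForm n X)
    fun i z hz X => volumeCoord_liftCoord (NeZero.ne n) hz X
  have hn' : (n : ℂ) ≠ 0 := by exact_mod_cast NeZero.ne n
  refine ⟨Ψ, ⟨fun i => ?_, fun x hx => ?_, fun z hz X => ?_⟩, fun Φ hΦ => ?_⟩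
  · change Differentiable ℂ (KForm.inChart (𝕜 := ℂ) Ψ i)
    rw [h1]
    exact differentiable_const _
  · have h3 : KForm.val (𝕜 := ℂ) Ψ x = 0 := hx
    rw [KForm.val_eq_inChart, h1] at h3
    have h4 := congrArg (fun f : (E n) [⋀^Fin n]→L[ℂ] ℂ =>
      f fun k => EuclideanSpace.single k 1) h3
    have h5 : (Matrix.of fun j k => (EuclideanSpace.single k (1 : ℂ) : E n) j) =
        (1 : Matrix (Fin n) (Fin n) ℂ) := by
      ext j k
      simp [Matrix.one_apply]
    simp only [ContinuousAlternatingMap.smul_apply, detForm_apply] at h4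
    rw [h5] at h4
    simp [hn'] at h4
  · rw [← detForm_apply]
    exact h2 z hz X
  · refine KForm.ext_of_pullback (𝕜 := ℂ) (fun i => (hΦ.holomorphic i).continuous) (fun i => ?_)
      fun z hz X => ?_
    · rw [h1]; exact continuous_const
    · rw [h2 z hz, detForm_apply]
      exact hΦ.pullback z hz X

end Volume

/-! ### Calabi's form -/

/-- The wedge product of two continuous linear functionals. -/
def wedge {V : Type*} [NormedAddCommGroup V] [NormedSpace ℝ V] (p q : V →L[ℝ] ℝ) :
    V [⋀^Fin 2]→L[ℝ] ℝ where
  toFun X := p (X 0) * q (X 1) - p (X 1) * q (X 0)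
  map_update_add' := @fun d X k x y => by
    rw [Subsingleton.elim d (instDecidableEqFin 2)]
    fin_cases k <;> simp <;> ring
  map_update_smul' := @fun d X k c x => by
    rw [Subsingleton.elim d (instDecidableEqFin 2)]
    fin_cases k <;> simp <;> ring
  cont := by fun_prop
  map_eq_zero_of_eq' X k l h hkl := by
    have h01 : X 0 = X 1 := by
      fin_cases k <;> fin_cases l <;> simp_all
    simp [h01]

theorem wedge_apply {V : Type*} [NormedAddCommGroup V] [NormedSpace ℝ V] (p q : V →L[ℝ] ℝ)
    (X : Fin 2 → V) : wedge p q X = p (X 0) * q (X 1) - p (X 1) * q (X 0) := rfl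

section Calabi

variable {n : ℕ}

/-- The real form `√-1 a ∧ ā` of a complex linear functional `a`. -/
def imForm (a : E n →L[ℂ] ℂ) : (E n) [⋀^Fin 2]→L[ℝ] ℝ :=
  (2 : ℝ) • wedge (Complex.reCLM ∘L a.restrictScalars ℝ) (Complex.imCLM ∘L a.restrictScalars ℝ)

theorem imForm_apply (a : E n →L[ℂ] ℂ) (X : Fin 2 → E n) :
    imForm a X = -2 * (a (X 0) * conj (a (X 1))).im := by
  simp [imForm, wedge_apply]
  ring

/-- The `j`-th coordinate of the derivative of `affVec i`. -/
def affProj (i j : Fin n) : E n →L[ℂ] ℂ :=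
  if j = i then 0 else (PiLp.proj 2 (fun _ : Fin n => ℂ) j : E n →L[ℂ] ℂ)

/-- `|ζ|²` for `ζ = affVec i w`. -/
def affNormSq (i : Fin n) (w : E n) : ℝ := ∑ j, ‖affVec i w j‖ ^ 2

/-- `∂ |ζ|²` for `ζ = affVec i w`. -/
def affDel (i : Fin n) (w : E n) : E n →L[ℂ] ℂ := ∑ j, conj (affVec i w j) • affProj i j

/-- `dwᵢ / n + wᵢ ∂ log |ζ|²` for `ζ = affVec i w`. -/
def fibreDel (i : Fin n) (w : E n) : E n →L[ℂ] ℂ :=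
  (n : ℂ)⁻¹ • (PiLp.proj 2 (fun _ : Fin n => ℂ) i : E n →L[ℂ] ℂ) +
    (w i / (affNormSq i w : ℂ)) • affDel i w

/-- `Uⁿ` in the `i`-th coordinates. -/
def affPow (i : Fin n) (w : E n) : ℝ := ‖w i‖ ^ 2 * affNormSq i w ^ n

/-- Calabi's form in the `i`-th coordinates. -/
def calabiCoord (i : Fin n) (w : E n) : (E n) [⋀^Fin 2]→L[ℝ] ℝ :=
  ((1 + affPow i w) ^ (1 / (n : ℝ))) •
      ((affNormSq i w)⁻¹ • ∑ j, imForm (affProj i j) -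
        ((affNormSq i w)⁻¹ ^ 2) • imForm (affDel i w)) +
    ((1 + affPow i w) ^ (1 / (n : ℝ) - 1) * affNormSq i w ^ n) • imForm (fibreDel i w)

/-- Written as the imaginary part of one Hermitian expression, the form can be compared with its
flat counterpart by algebra over ℂ. -/
theorem calabiCoord_apply (i : Fin n) (w : E n) (X : Fin 2 → E n) :
    calabiCoord i w X = -2 * (((1 + affPow i w) ^ (1 / (n : ℝ)) : ℝ) *
      ((∑ j, affProj i j (X 0) * conj (affProj i j (X 1))) / affNormSq i w -
        affDel i w (X 0) * conj (affDel i w (X 1)) / (affNormSq i w : ℂ) ^ 2) +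
      ((1 + affPow i w) ^ (1 / (n : ℝ) - 1) * affNormSq i w ^ n : ℝ) *
        (fibreDel i w (X 0) * conj (fibreDel i w (X 1)))).im := by
  have h1 : ∀ (q : ℂ) (V : ℝ), (q / V).im = q.im / V := fun q V => Complex.div_ofReal_im q V
  have h2 : (affNormSq i w : ℂ) ^ 2 = ((affNormSq i w ^ 2 : ℝ) : ℂ) := by push_cast; rfl
  simp only [calabiCoord, ContinuousAlternatingMap.add_apply, ContinuousAlternatingMap.smul_apply,
    ContinuousAlternatingMap.sub_apply, ContinuousAlternatingMap.sum_apply, imForm_apply,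
    Complex.add_im, Complex.im_ofReal_mul, Complex.sub_im, h2, h1, Complex.im_sum, smul_eq_mul,
    ← Finset.mul_sum]
  ring

theorem one_le_affNormSq (i : Fin n) (w : E n) : 1 ≤ affNormSq i w := by
  have := Finset.single_le_sum (f := fun j => ‖affVec i w j‖ ^ 2) (fun j _ => by positivity)
    (Finset.mem_univ i)
  simpa [affNormSq] using this

theorem affNormSq_pos (i : Fin n) (w : E n) : 0 < affNormSq i w :=
  one_pos.trans_le (one_le_affNormSq i w)

theorem affPow_nonneg (i : Fin n) (w : E n) : 0 ≤ affPow i w := by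
  have := affNormSq_pos i w
  unfold affPow
  positivity

theorem contDiff_affVec_apply (i j : Fin n) : ContDiff ℝ ∞ fun w : E n => affVec i w j := by
  have h : ContDiff ℝ ∞ fun v : E n => v j := by fun_prop
  exact h.comp (contDiff_affVec ℝ ∞ i)

theorem contDiff_affNormSq (i : Fin n) : ContDiff ℝ ∞ (affNormSq i) := by
  unfold affNormSq
  exact ContDiff.sum fun j _ => (contDiff_affVec_apply i j).norm_sq ℝ

theorem contDiff_affDel (i : Fin n) (X : E n) : ContDiff ℝ ∞ fun w : E n => affDel i w X := by
  simp only [affDel, _root_.sum_apply, _root_.smul_apply, smul_eq_mul]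
  exact ContDiff.sum fun j _ =>
    (Complex.conjCLE.contDiff.comp (contDiff_affVec_apply i j)).mul contDiff_const

theorem contDiff_fibreDel (i : Fin n) (X : E n) : ContDiff ℝ ∞ fun w : E n => fibreDel i w X := by
  simp only [fibreDel, _root_.add_apply, _root_.smul_apply, smul_eq_mul,
    div_eq_mul_inv]
  have h1 : ContDiff ℝ ∞ fun w : E n => ((affNormSq i w : ℂ))⁻¹ :=
    (Complex.ofRealCLM.contDiff.comp (contDiff_affNormSq i)).inv fun w => by
      simpa using (affNormSq_pos i w).ne'
  have h2 : ContDiff ℝ ∞ fun w : E n => w i := by fun_prop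
  exact contDiff_const.add ((h2.mul h1).mul (contDiff_affDel i X))

theorem contDiff_affPow (i : Fin n) : ContDiff ℝ ∞ (affPow i) := by
  have h2 : ContDiff ℝ ∞ fun w : E n => w i := by fun_prop
  exact (h2.norm_sq ℝ).mul ((contDiff_affNormSq i).pow n)

theorem ContDiff.imForm_apply {a : E n → E n →L[ℂ] ℂ} (ha : ∀ X, ContDiff ℝ ∞ fun w => a w X)
    (X : Fin 2 → E n) : ContDiff ℝ ∞ fun w => imForm (a w) X := by
  simp only [CalabiModel.imForm_apply]
  exact contDiff_const.mul (Complex.imCLM.contDiff.comp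
    ((ha _).mul (Complex.conjCLE.contDiff.comp (ha _))))

theorem contDiff_calabiCoord_apply (i : Fin n) (X : Fin 2 → E n) :
    ContDiff ℝ ∞ fun w => calabiCoord i w X := by
  simp only [calabiCoord, ContinuousAlternatingMap.add_apply, ContinuousAlternatingMap.smul_apply,
    ContinuousAlternatingMap.sub_apply, smul_eq_mul]
  have h1 : ∀ p : ℝ, ContDiff ℝ ∞ fun w : E n => (1 + affPow i w) ^ p := fun p =>
    (contDiff_const.add (contDiff_affPow i)).rpow_const_of_ne fun w => by
      have := affPow_nonneg i w
      positivity
  have h2 : ContDiff ℝ ∞ fun w : E n => (affNormSq i w)⁻¹ :=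
    (contDiff_affNormSq i).inv fun w => (affNormSq_pos i w).ne'
  exact ((h1 _).mul ((h2.mul contDiff_const).sub ((h2.pow 2).mul
    (ContDiff.imForm_apply (contDiff_affDel i) X)))).add
    (((h1 _).mul ((contDiff_affNormSq i).pow n)).mul (ContDiff.imForm_apply (contDiff_fibreDel i) X))

end Calabi

/-- A map into alternating `2`-forms on a finite-dimensional space is smooth if its values on
vectors are. -/
theorem contDiff_alternatingMap_two {V F : Type*} [NormedAddCommGroup V] [NormedSpace ℝ V]
    [FiniteDimensional ℝ V] [NormedAddCommGroup F] [NormedSpace ℝ F] {m : WithTop ℕ∞}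
    {f : F → V [⋀^Fin 2]→L[ℝ] ℝ} (hf : ∀ X, ContDiff ℝ m fun w => f w X) : ContDiff ℝ m f := by
  let b := Module.finBasis ℝ V
  let B : Fin (Module.finrank ℝ V) → V →L[ℝ] ℝ := fun k => LinearMap.toContinuousLinearMap (b.coord k)
  have hB : ∀ k l, B k (b l) = if l = k then 1 else 0 := fun k l => by
    simp [B, Finsupp.single_apply]
  -- Expansion in a basis; the sum runs over ordered pairs, so each coefficient occurs twice and is
  -- halved.
  have key : f = fun w => ∑ k, ∑ l, f w ![b k, b l] • (2⁻¹ : ℝ) • wedge (B k) (B l) := by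
    funext w
    refine ContinuousAlternatingMap.toAlternatingMap_injective (b.ext_alternating fun v hv => ?_)
    change f w (fun i => b (v i)) = (∑ k, ∑ l, f w ![b k, b l] • (2⁻¹ : ℝ) • wedge (B k) (B l)) (fun i => b (v i))
    have hsw : f w ![b (v 1), b (v 0)] = - f w ![b (v 0), b (v 1)] := by
      have := (f w).toAlternatingMap.map_swap ![b (v 0), b (v 1)] (i := 0) (j := 1) (by simp)
      rw [← show (![b (v 0), b (v 1)] ∘ Equiv.swap (0 : Fin 2) 1) = ![b (v 1), b (v 0)] by
        funext i; fin_cases i <;> simp]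
      exact this
    have he : (fun i => b (v i)) = ![b (v 0), b (v 1)] := by
      funext i; fin_cases i <;> rfl
    rw [he]
    simp only [ContinuousAlternatingMap.sum_apply, ContinuousAlternatingMap.smul_apply, wedge_apply,
      Matrix.cons_val_zero, Matrix.cons_val_one, hB, smul_eq_mul, mul_sub, Finset.sum_sub_distrib, mul_ite, mul_one, mul_zero,
      Finset.sum_ite_eq, Finset.mem_univ, if_true, hsw]
    ring
  rw [key]
  exact ContDiff.sum fun k _ => ContDiff.sum fun l _ => (hf _).smul contDiff_const

theorem contDiff_calabiCoord {n : ℕ} (i : Fin n) : ContDiff ℝ ∞ (calabiCoord i) :=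
  contDiff_alternatingMap_two (contDiff_calabiCoord_apply i)

/-! ### The pull-back of the coordinate expression to ℂⁿ ∖ 0 -/

section CalabiFlat

variable {n : ℕ}

theorem calabiDeriv_eq (hn : n ≠ 0) {U : ℝ} (hU : 0 < U) :
    calabiDeriv n U = (1 + U ^ n) ^ (1 / (n : ℝ)) / U := by
  have h : 1 + 1 / U ^ n = (1 + U ^ n) / U ^ n := by field_simp; ring
  rw [calabiDeriv, h, Real.div_rpow (by positivity) (by positivity), one_div,
    Real.pow_rpow_inv_natCast hU.le hn]

/-- The first summand combines with f'(U) ∂∂̄U into a multiple of ∂∂̄ log U; the second becomes the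
fibre term. -/
theorem deriv_calabiDeriv (hn : n ≠ 0) {U : ℝ} (hU : 0 < U) :
    deriv (calabiDeriv n) U = -((1 + U ^ n) ^ (1 / (n : ℝ)) / U ^ 2) +
      (1 + U ^ n) ^ (1 / (n : ℝ) - 1) * U ^ n / U ^ 2 := by
  have hn' : (n : ℝ) ≠ 0 := by exact_mod_cast hn
  have he : calabiDeriv n =ᶠ[𝓝 U] fun U => (1 + U ^ n) ^ (1 / (n : ℝ)) / U := by
    filter_upwards [lt_mem_nhds hU] with V hV using calabiDeriv_eq hn hV
  rw [he.deriv_eq]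
  have h1 : HasDerivAt (fun U : ℝ => 1 + U ^ n) (n * U ^ (n - 1)) U :=
    (hasDerivAt_pow n U).const_add 1
  have h2 := (h1.rpow_const (p := 1 / (n : ℝ)) (Or.inl (by positivity))).div (hasDerivAt_id U) hU.ne'
  refine (HasDerivAt.deriv h2).trans ?_
  have hp : U ^ n = U ^ (n - 1) * U := by rw [← pow_succ, Nat.sub_add_cancel (by omega)]
  simp only [id]
  generalize (1 + U ^ n) ^ (1 / (n : ℝ) - 1) = a
  generalize (1 + U ^ n) ^ (1 / (n : ℝ)) = b
  rw [hp]
  field_simp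
  ring

/-- The flat expression of Calabi's form, as a real number. -/
def calabiReal (z : E n) (X : Fin 2 → E n) : ℝ :=
  -2 * ((calabiDeriv n (∑ j, ‖z j‖ ^ 2) : ℝ) * (∑ j, X 0 j * conj (X 1 j)) +
    (deriv (calabiDeriv n) (∑ j, ‖z j‖ ^ 2) : ℝ) *
      ((∑ j, conj (z j) * X 0 j) * conj (∑ j, conj (z j) * X 1 j))).im

theorem ofReal_calabiReal (z : E n) (X : Fin 2 → E n) :
    (calabiReal z X : ℂ) = calabiFlat z (X 0) (X 1) := by
  have h : ∀ q : ℂ, ((-2 * q.im : ℝ) : ℂ) = Complex.I * (q - conj q) := fun q => by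
    apply Complex.ext <;> simp; ring
  rw [calabiReal, h]
  simp only [calabiFlat, map_add, map_mul, Complex.conj_ofReal, map_sum, Complex.conj_conj,
    Finset.sum_sub_distrib]
  have h2 : ∑ j, conj (X 0 j) * X 1 j = ∑ j, X 1 j * conj (X 0 j) :=
    Finset.sum_congr rfl fun j _ => mul_comm _ _
  rw [h2]
  ring

/-- The formula is uniform in j: for j = i the two terms cancel, as they must since ζᵢ = 1 is
constant. -/
theorem affProj_fderiv_liftCoord {i : Fin n} {z : E n} (hz : z i ≠ 0) (j : Fin n) (X : E n) :
    affProj i j (fderiv ℝ (liftCoord i) z X) = (z i)⁻¹ * X j + -(X i / z i ^ 2) * z j := by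
  by_cases h : j = i
  · subst h
    simp [affProj]
    field_simp
    ring
  · rw [← fderiv_liftCoord_of_ne ℝ h hz]
    simp [affProj, h]

theorem sum_norm_sq_pos {z : E n} {i : Fin n} (hz : z i ≠ 0) : 0 < ∑ j, ‖z j‖ ^ 2 :=
  Finset.sum_pos' (fun j _ => by positivity) ⟨i, Finset.mem_univ i, by positivity⟩

theorem affNormSq_liftCoord {i : Fin n} {z : E n} (hz : z i ≠ 0) :
    affNormSq i (liftCoord i z) = ‖(z i)⁻¹‖ ^ 2 * ∑ j, ‖z j‖ ^ 2 := by
  simp [affNormSq, affVec_liftCoord hz, mul_pow, Finset.mul_sum]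

theorem affPow_liftCoord {i : Fin n} {z : E n} (hz : z i ≠ 0) :
    affPow i (liftCoord i z) = (∑ j, ‖z j‖ ^ 2) ^ n := by
  have : ‖z i‖ ≠ 0 := by simpa using hz
  have h : (‖(z i)⁻¹‖ ^ 2) ^ n = ((‖z i‖ ^ n) ^ 2)⁻¹ := by
    rw [norm_inv, ← pow_mul, ← pow_mul, inv_pow, mul_comm]
  rw [affPow, affNormSq_liftCoord hz, liftCoord_self, mul_pow, norm_pow, h]
  exact mul_inv_cancel_left₀ (by positivity) _

theorem sum_conj_mul_self (z : E n) : ∑ j, conj (z j) * z j = ((∑ j, ‖z j‖ ^ 2 : ℝ) : ℂ) := by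
  push_cast
  exact Finset.sum_congr rfl fun j _ => Complex.conj_mul' _

theorem affDel_fderiv_liftCoord {i : Fin n} {z : E n} (hz : z i ≠ 0) (X : E n) :
    affDel i (liftCoord i z) (fderiv ℝ (liftCoord i) z X) =
      conj (z i)⁻¹ * ((z i)⁻¹ * (∑ j, conj (z j) * X j) +
        -(X i / z i ^ 2) * ((∑ j, ‖z j‖ ^ 2 : ℝ) : ℂ)) := by
  rw [← sum_conj_mul_self]
  simp only [affDel, _root_.sum_apply, _root_.smul_apply, smul_eq_mul, affProj_fderiv_liftCoord hz,
    affVec_liftCoord hz, Finset.mul_sum, mul_add, ← Finset.sum_add_distrib, PiLp.smul_apply,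
    map_mul]
  exact Finset.sum_congr rfl fun j _ => by ring

theorem sum_affProj_fderiv_liftCoord {i : Fin n} {z : E n} (hz : z i ≠ 0) (X Y : E n) :
    ∑ j, affProj i j (fderiv ℝ (liftCoord i) z X) * conj (affProj i j (fderiv ℝ (liftCoord i) z Y))
      = (z i)⁻¹ * conj (z i)⁻¹ * (∑ j, X j * conj (Y j)) +
        (z i)⁻¹ * conj (-(Y i / z i ^ 2)) * (∑ j, conj (z j) * X j) +
        -(X i / z i ^ 2) * conj (z i)⁻¹ * conj (∑ j, conj (z j) * Y j) +
        -(X i / z i ^ 2) * conj (-(Y i / z i ^ 2)) * ((∑ j, ‖z j‖ ^ 2 : ℝ) : ℂ) := by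
  rw [← sum_conj_mul_self]
  simp only [affProj_fderiv_liftCoord hz, map_sum, Finset.mul_sum, ← Finset.sum_add_distrib,
    map_add, map_mul, Complex.conj_conj]
  exact Finset.sum_congr rfl fun j _ => by ring

/-- The functional α pulls back to zᵢⁿ ∂ log U: dwᵢ/n is zᵢⁿ dzᵢ/zᵢ, and ∂ log|ζ|² is ∂ log U -
dzᵢ/zᵢ, so the dzᵢ terms cancel. -/
theorem fibreDel_fderiv_liftCoord (hn : n ≠ 0) {i : Fin n} {z : E n} (hz : z i ≠ 0) (X : E n) :
    fibreDel i (liftCoord i z) (fderiv ℝ (liftCoord i) z X) =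
      z i ^ n * (∑ j, conj (z j) * X j) / ((∑ j, ‖z j‖ ^ 2 : ℝ) : ℂ) := by
  have hn' : (n : ℂ) ≠ 0 := by exact_mod_cast hn
  have hU : ((∑ j, ‖z j‖ ^ 2 : ℝ) : ℂ) ≠ 0 := by exact_mod_cast (sum_norm_sq_pos hz).ne'
  have hcz : starRingEnd ℂ (z i) ≠ 0 := by simpa using hz
  have hV : (affNormSq i (liftCoord i z) : ℂ) =
      (z i)⁻¹ * starRingEnd ℂ (z i)⁻¹ * ((∑ j, ‖z j‖ ^ 2 : ℝ) : ℂ) := by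
    rw [affNormSq_liftCoord hz, Complex.mul_conj']
    push_cast
    rfl
  simp only [fibreDel, _root_.add_apply, _root_.smul_apply, smul_eq_mul, liftCoord_self, hV,
    affDel_fderiv_liftCoord hz, PiLp.proj_apply, fderiv_liftCoord_self ℝ hz]
  generalize ((∑ j, ‖z j‖ ^ 2 : ℝ) : ℂ) = U at hU ⊢
  generalize (∑ j, conj (z j) * X j) = D
  have hp : z i ^ n = z i ^ (n - 1) * z i := by rw [← pow_succ, Nat.sub_add_cancel (by omega)]
  rw [hp, map_inv₀]
  field_simp
  ring

/-- With a and b as in the formula for ω, f' = a/U and f'' = -a/U² + b Uⁿ/U². The a-terms form a ∂∂̄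
log U = a ∂∂̄ log|ζ|², as log|zᵢ|² is pluriharmonic; the b-term is b |ζ|²ⁿ α ∧ ᾱ because |zᵢⁿ|²
|ζ|²ⁿ = Uⁿ. -/
theorem calabiCoord_liftCoord (hn : n ≠ 0) {i : Fin n} {z : E n} (hz : z i ≠ 0)
    (X : Fin 2 → E n) :
    calabiCoord i (liftCoord i z) (fun k => fderiv ℝ (liftCoord i) z (X k)) = calabiReal z X := by
  have hU0 := sum_norm_sq_pos hz
  have hU : ((∑ j, ‖z j‖ ^ 2 : ℝ) : ℂ) ≠ 0 := by exact_mod_cast hU0.ne'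
  have hcz : starRingEnd ℂ (z i) ≠ 0 := by simpa using hz
  have hV : (affNormSq i (liftCoord i z) : ℂ) =
      (z i)⁻¹ * starRingEnd ℂ (z i)⁻¹ * ((∑ j, ‖z j‖ ^ 2 : ℝ) : ℂ) := by
    rw [affNormSq_liftCoord hz, Complex.mul_conj']
    push_cast
    rfl
  rw [calabiCoord_apply, calabiReal, calabiDeriv_eq hn hU0, deriv_calabiDeriv hn hU0]
  simp only [affPow_liftCoord hz, sum_affProj_fderiv_liftCoord hz, affDel_fderiv_liftCoord hz,
    fibreDel_fderiv_liftCoord hn hz]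
  generalize ∑ j, ‖z j‖ ^ 2 = U at hU0 hU hV ⊢
  generalize ∑ j, conj (z j) * X 1 j = D'
  generalize ∑ j, conj (z j) * X 0 j = D
  generalize ∑ j, X 0 j * conj (X 1 j) = H
  generalize (1 + U ^ n) ^ (1 / (n : ℝ)) = a
  generalize (1 + U ^ n) ^ (1 / (n : ℝ) - 1) = b
  push_cast [hV]
  simp only [map_mul, map_div₀, map_add, map_neg, map_pow, map_inv₀, Complex.conj_ofReal,
    Complex.conj_conj, mul_pow, inv_pow]
  congr 2
  generalize starRingEnd ℂ (z i) = c at hcz ⊢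
  generalize starRingEnd ℂ (X 1 i) = y
  field_simp
  ring

variable [NeZero n]

theorem exists_calabiForm (n : ℕ) [NeZero n] : ∃ η : KForm ℝ n 2,
    (∀ i, η.inChart i = calabiCoord i) ∧
    ∀ z : E n, z ≠ 0 → ∀ X : Fin 2 → E n,
      η (lift z) (fun k => mfderiv 𝓘(ℝ, E n) 𝓘(ℝ, E n) lift z (X k)) = calabiReal z X :=
  exists_kForm (fun i => (contDiff_calabiCoord i).continuous)
    fun _ _ hz X => calabiCoord_liftCoord (NeZero.ne n) hz X

theorem IsCalabiForm.pullback_eq {η : TwoForm n} (hη : IsCalabiForm η) {z : E n} (hz : z ≠ 0)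
    (X : Fin 2 → E n) :
    η (lift z) (fun k => mfderiv 𝓘(ℝ, E n) 𝓘(ℝ, E n) lift z (X k)) = calabiReal z X := by
  have h := hη.pullback z hz (X 0) (X 1)
  rw [← ofReal_calabiReal] at h
  rw [← Complex.ofReal_inj, ← h]
  congr 2
  funext k
  fin_cases k <;> rfl

theorem IsCalabiForm.eq_of_pullback {η : TwoForm n} (hη : IsCalabiForm η) {η' : KForm ℝ n 2}
    (h1 : ∀ i, η'.inChart i = calabiCoord i) (h2 : ∀ z : E n, z ≠ 0 → ∀ X : Fin 2 → E n,
      η' (lift z) (fun k => mfderiv 𝓘(ℝ, E n) 𝓘(ℝ, E n) lift z (X k)) = calabiReal z X) :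
    η = η' :=
  KForm.ext_of_pullback (𝕜 := ℝ) (fun i => (hη.smooth i).continuous)
    (fun i => by rw [h1]; exact (contDiff_calabiCoord i).continuous)
    fun z hz X => (hη.pullback_eq hz X).trans (h2 z hz X).symm

theorem isCalabiForm_inChart {η : TwoForm n} (hη : IsCalabiForm η) (i : Fin n) :
    KForm.inChart (𝕜 := ℝ) η i = calabiCoord i := by
  obtain ⟨η', h1, h2⟩ := exists_calabiForm n
  rw [hη.eq_of_pullback h1 h2, h1]

theorem existsUnique_isCalabiForm (n : ℕ) [NeZero n] : ∃! η : TwoForm n, IsCalabiForm η := by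
  obtain ⟨η, h1, h2⟩ := exists_calabiForm n
  refine ⟨η, ⟨fun i => ?_, fun z hz X Y => ?_⟩, fun η' h => h.eq_of_pullback h1 h2⟩
  · change ContDiff ℝ ∞ (KForm.inChart (𝕜 := ℝ) η i)
    rw [h1]
    exact contDiff_calabiCoord i
  · have h := h2 z hz ![X, Y]
    rw [← Complex.ofReal_inj, ofReal_calabiReal] at h
    refine Eq.trans ?_ h
    congr 2
    funext k
    fin_cases k <;> rfl

end CalabiFlat

/-! ### Linear automorphisms of `K` and real points -/

section Real

variable {n : ℕ}

/-- The flat form is built from the norm and the Hermitian product alone. -/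
theorem calabiReal_map (M : E n ≃ₗᵢ[ℂ] E n) (z : E n) (X : Fin 2 → E n) :
    calabiReal (M z) (fun k => M (X k)) = calabiReal z X := by
  have h1 : ∀ v : E n, ∑ j, ‖v j‖ ^ 2 = ‖v‖ ^ 2 := fun v => (EuclideanSpace.norm_sq_eq v).symm
  have h2 : ∀ v Y : E n, ∑ j, conj (v j) * Y j = inner ℂ v Y := fun v Y => by
    simp [PiLp.inner_apply, mul_comm]
  have h3 : ∀ v Y : E n, ∑ j, v j * conj (Y j) = inner ℂ Y v := fun v Y => by
    simp [PiLp.inner_apply]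
  simp only [calabiReal, h1, h2, h3, M.norm_map, M.inner_map_map]

/-- The real points of `ℂⁿ`. -/
def realSub (n : ℕ) : Submodule ℝ (E n) where
  carrier := {w | ∀ j, (w j).im = 0}
  zero_mem' := by simp
  add_mem' ha hb j := by simp [ha j, hb j]
  smul_mem' c a ha j := by simp [ha j]

/-- The real points of `ℂⁿ` are `ℝⁿ`. -/
def realSubEquiv (n : ℕ) : (Fin n → ℝ) ≃ₗ[ℝ] realSub n where
  toFun y := ⟨WithLp.toLp 2 fun j => (y j : ℂ), fun j => by simp⟩
  map_add' x y := by ext j; simp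
  map_smul' c y := by ext j; simp
  invFun w j := (w.1 j).re
  left_inv y := by ext j; simp
  right_inv w := by
    ext j
    exact Complex.ext rfl (by simpa using (w.2 j).symm)

theorem finrank_realSub (n : ℕ) : Module.finrank ℝ (realSub n) = n := by
  rw [← (realSubEquiv n).finrank_eq, Module.finrank_fin_fun]

theorem isClosed_realSub (n : ℕ) : IsClosed (realSub n : Set (E n)) :=
  (realSub n).closed_of_finiteDimensional

/-- At a real point every functional involved is real on real vectors, and √-1 a ∧ ā is -2 Im of
a(X) times the conjugate of a(Y). -/
theorem calabiCoord_eq_zero_of_real (i : Fin n) {w : E n} (hw : w ∈ realSub n) {X : Fin 2 → E n}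
    (hX : ∀ k, X k ∈ realSub n) : calabiCoord i w X = 0 := by
  have h0 : ∀ {a b : ℂ}, a.im = 0 → b.im = 0 → (a * b).im = 0 := fun ha hb => by
    simp [Complex.mul_im, ha, hb]
  have hp : ∀ j k, (affProj i j (X k)).im = 0 := by
    intro j k
    by_cases h : j = i
    · simp [affProj, h]
    · simpa [affProj, h] using hX k j
  have hd : ∀ k, (affDel i w (X k)).im = 0 := by
    intro k
    simp only [affDel, _root_.sum_apply, _root_.smul_apply, Complex.im_sum, smul_eq_mul]
    refine Finset.sum_eq_zero fun j _ => h0 ?_ (hp j k)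
    by_cases h : j = i
    · simp [h]
    · simp [affVec, h, hw j]
  have hf : ∀ k, (fibreDel i w (X k)).im = 0 := by
    intro k
    have h1 : ((n : ℂ)⁻¹).im = 0 := by
      rw [← Complex.ofReal_natCast, ← Complex.ofReal_inv, Complex.ofReal_im]
    have h2 : (w i / (affNormSq i w : ℂ)).im = 0 := by
      rw [Complex.div_ofReal_im, hw i, zero_div]
    simp only [fibreDel, _root_.add_apply, _root_.smul_apply, smul_eq_mul, Complex.add_im,
      PiLp.proj_apply]
    rw [h0 h1 (hX k i), h0 h2 (hd k), add_zero]
  have hq : ∀ a : E n →L[ℂ] ℂ, (∀ k, (a (X k)).im = 0) → imForm a X = 0 := by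
    intro a ha
    rw [imForm_apply, h0 (ha 0) (by simp [ha 1]), mul_zero]
  simp only [calabiCoord, ContinuousAlternatingMap.add_apply, ContinuousAlternatingMap.smul_apply,
    ContinuousAlternatingMap.sub_apply, ContinuousAlternatingMap.sum_apply, hq _ hd, hq _ hf,
    hq _ (hp _), Finset.sum_const_zero, smul_zero, sub_zero, add_zero]

theorem detForm_im_of_real {X : Fin n → E n} (hX : ∀ k, X k ∈ realSub n) :
    (detForm n X).im = 0 := by
  rw [detForm_apply]
  have h : (Matrix.of fun j k => X k j) =
      (Matrix.of fun j k => (X k j).re).map (Complex.ofRealHom : ℝ →+* ℂ) := by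
    ext j k
    exact Complex.ext rfl (by simpa using hX k j)
  rw [h, ← RingHom.mapMatrix_apply, ← RingHom.map_det]
  simp

end Real

/-! ### Linear automorphisms of K and the charts adapted to them -/

section Action

variable {n : ℕ}

/-- The action of a linear automorphism on pairs `(z, t)`. -/
def preAct (M : E n ≃L[ℂ] E n) (p : PreK n) : PreK n :=
  ⟨(M p.1.1, p.1.2), by simpa using p.2⟩

/-- The automorphism `t z^{⊗ n} ↦ t (M z)^{⊗ n}` of `K`. -/
def kMap (M : E n ≃L[ℂ] E n) : K n → K n :=
  Quotient.lift (fun p => K.mk (preAct M p)) (by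
    rintro p q ⟨l, hl, h1, h2⟩
    exact K.mk_eq_iff.2 ⟨l, hl, by simp [preAct, h1], h2⟩)

theorem kMap_mk (M : E n ≃L[ℂ] E n) (p : PreK n) : kMap M (K.mk p) = K.mk (preAct M p) := rfl

theorem continuous_kMap (M : E n ≃L[ℂ] E n) : Continuous (kMap M) := by
  rw [(K.isQuotientMap_mk n).continuous_iff]
  refine (K.isQuotientMap_mk n).continuous.comp (Continuous.subtype_mk ?_ _)
  exact (M.continuous.comp (continuous_fst.comp continuous_subtype_val)).prodMk
    (continuous_snd.comp continuous_subtype_val)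

theorem kMap_symm_kMap (M : E n ≃L[ℂ] E n) (x : K n) : kMap M.symm (kMap M x) = x := by
  obtain ⟨p, rfl⟩ := K.mk_surjective n x
  rw [kMap_mk, kMap_mk]
  congr 1
  exact Subtype.ext (Prod.ext (M.symm_apply_apply _) rfl)

/-- `kMap` as a homeomorphism. -/
def kAct (M : E n ≃L[ℂ] E n) : K n ≃ₜ K n where
  toFun := kMap M
  invFun := kMap M.symm
  left_inv := kMap_symm_kMap M
  right_inv := kMap_symm_kMap M.symm
  continuous_toFun := continuous_kMap M
  continuous_invFun := continuous_kMap M.symm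

/-- The chart of `K` that takes the lift of `M ℝⁿ` to `ℝⁿ`. -/
def linChart (M : E n ≃L[ℂ] E n) (i : Fin n) : OpenPartialHomeomorph (K n) (E n) :=
  (kAct M.symm).transOpenPartialHomeomorph (chart i)

theorem linChart_mk (M : E n ≃L[ℂ] E n) (i : Fin n) (p : PreK n) :
    linChart M i (K.mk p) = preCoord i (M.symm p.1.1, p.1.2) := rfl

theorem mk_mem_linChart_source {M : E n ≃L[ℂ] E n} {i : Fin n} {p : PreK n} :
    K.mk p ∈ (linChart M i).source ↔ M.symm p.1.1 i ≠ 0 :=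
  mk_mem_dom (p := preAct M.symm p)

theorem exists_mem_linChart_source (M : E n ≃L[ℂ] E n) (x : K n) :
    ∃ i, x ∈ (linChart M i).source :=
  exists_mem_dom (kMap M.symm x)

/-- The transitions to and from the blow-up charts are `transCoord` for M and its inverse, smooth
where they are defined. -/
theorem linChart_mem_maximalAtlas (M : E n ≃L[ℂ] E n) (i : Fin n) :
    linChart M i ∈ IsManifold.maximalAtlas 𝓘(ℝ, E n) ∞ (K n) := by
  rw [IsManifold.mem_maximalAtlas_iff, mem_maximalAtlas_iff]
  rintro _ ⟨j, rfl⟩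
  have h1 : ContDiffOn ℝ ∞ (transCoord M i j) {w | M (affVec i w) j ≠ 0} := fun w hw =>
    (contDiffAt_transCoord ℝ ∞ M i j hw).contDiffWithinAt
  have h2 : ContDiffOn ℝ ∞ (transCoord M.symm j i) {w | M.symm (affVec j w) i ≠ 0} := fun w hw =>
    (contDiffAt_transCoord ℝ ∞ M.symm j i hw).contDiffWithinAt
  have e1 : ∀ w ∈ ((linChart M i).symm ≫ₕ chart j).source, M (affVec i w) j ≠ 0 := fun w hw =>
    mk_mem_dom.1 hw.2
  have e2 : ∀ w ∈ ((chart j).symm ≫ₕ linChart M i).source, M.symm (affVec j w) i ≠ 0 :=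
    fun w hw => mk_mem_dom.1 hw.2
  constructor
  · rw [contDiffGroupoid, mem_groupoid_of_pregroupoid]
    exact ⟨(h1.mono fun w hw => e1 w hw.1), (h2.mono fun w hw => e2 w hw.1)⟩
  · rw [contDiffGroupoid, mem_groupoid_of_pregroupoid]
    exact ⟨(h2.mono fun w hw => e2 w hw.1), (h1.mono fun w hw => e1 w hw.1)⟩

end Action

/-! ### The lifts of a totally real plane -/

section Strict

variable {n : ℕ}

/-- A point t z^{⊗n} over [z'] with z' ≠ 0 is z'^{⊗n}: z' and t^{1/n} z differ by an n-th root of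
unity, which the tensor power does not see. Strict transforms thereby become closures of images of
the lift. -/
theorem mem_preimage_blowDown_iff [NeZero n] {S : Set (E n)} {x : K n} :
    x ∈ blowDown ⁻¹' (Orb.mk '' S \ {Orb.mk 0}) ↔ x ∈ lift '' (S \ {0}) := by
  constructor
  · rintro ⟨⟨z', hz', hx⟩, h0⟩
    obtain ⟨p, rfl⟩ := K.mk_surjective n x
    have hr := cpow_root_pow n p.1.2
    have hb : blowDown (K.mk p) = Orb.mk (p.1.2 ^ ((n : ℂ)⁻¹) • p.1.1) := rfl
    rw [hb] at hx h0
    generalize p.1.2 ^ ((n : ℂ)⁻¹) = r at hr hx h0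
    obtain ⟨ζ, hζ, h⟩ := Quotient.exact hx
    have hζ0 : ζ ≠ 0 := by
      rintro rfl
      simp [NeZero.ne n] at hζ
    have hr0 : r ≠ 0 := by
      rintro rfl
      simp at h0
    have hz : z' = (ζ⁻¹ * r) • p.1.1 := by
      rw [mul_smul, h, smul_smul, inv_mul_cancel₀ hζ0, one_smul]
    have hl : ζ⁻¹ * r ≠ 0 := mul_ne_zero (inv_ne_zero hζ0) hr0
    have hz0 : z' ≠ 0 := by rw [hz]; exact smul_ne_zero hl p.2
    refine ⟨z', ⟨hz', hz0⟩, ?_⟩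
    rw [lift_of_ne hz0]
    refine (K.mk_eq_iff.2 ⟨ζ⁻¹ * r, hl, hz, ?_⟩).symm
    rw [mul_pow, inv_pow, hζ, hr]
    simp
  · rintro ⟨z, ⟨hz, hz0⟩, rfl⟩
    rw [mem_preimage, blowDown_lift hz0]
    refine ⟨mem_image_of_mem _ hz, fun h => hz0 ?_⟩
    obtain ⟨ζ, hζ, h'⟩ := Quotient.exact h
    have hζ0 : ζ ≠ 0 := by
      rintro rfl
      simp [NeZero.ne n] at hζ
    simpa [hζ0] using h'.symm

theorem strictTransform_eq [NeZero n] (S : Set (E n)) : strictTransform S = closure (lift '' (S \ {0})) := by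
  rw [strictTransform]
  congr 1
  ext x
  exact mem_preimage_blowDown_iff

/-- The points `t (M y)^{⊗ n}` with `y` and `t` real. -/
def fullLift (M : E n ≃L[ℂ] E n) : Set (K n) :=
  {x | ∃ p : PreK n, K.mk p = x ∧ M.symm p.1.1 ∈ realSub n ∧ p.1.2.im = 0}

/-- The points `t (M y)^{⊗ n}` with `y` real and `t ≥ 0`. -/
def halfLift (M : E n ≃L[ℂ] E n) : Set (K n) :=
  {x | ∃ p : PreK n, K.mk p = x ∧ M.symm p.1.1 ∈ realSub n ∧ p.1.2.im = 0 ∧ 0 ≤ p.1.2.re}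

theorem halfLift_subset_fullLift (M : E n ≃L[ℂ] E n) : halfLift M ⊆ fullLift M :=
  fun _ ⟨p, h, h1, h2, _⟩ => ⟨p, h, h1, h2⟩

theorem halfLift_eq_fullLift (hn : Odd n) (M : E n ≃L[ℂ] E n) : halfLift M = fullLift M := by
  refine (halfLift_subset_fullLift M).antisymm ?_
  rintro _ ⟨p, rfl, h1, h2⟩
  by_cases h : 0 ≤ p.1.2.re
  · exact ⟨p, rfl, h1, h2, h⟩
  · refine ⟨⟨(-p.1.1, -p.1.2), neg_ne_zero.2 p.2⟩, ?_, ?_, ?_, ?_⟩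
    · exact (K.mk_eq_iff.2 ⟨-1, by simp, by simp, by simp [hn.neg_one_pow]⟩).symm
    · dsimp only
      rw [map_neg]
      exact neg_mem h1
    · simp [h2]
    · simp only [Complex.neg_re]
      linarith

theorem exists_ofReal_mul_pow {t y : ℂ} (ht : t.im = 0) (hy : y.im = 0) :
    t * y ^ n = ((t.re * y.re ^ n : ℝ) : ℂ) := by
  have h1 : t = (t.re : ℂ) := Complex.ext rfl (by simpa using ht)
  have h2 : y = (y.re : ℂ) := Complex.ext rfl (by simpa using hy)
  conv_lhs => rw [h1, h2]
  push_cast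
  rfl

theorem preCoord_mem_realSub (i : Fin n) {y : E n} {t : ℂ} (hy : y ∈ realSub n) (ht : t.im = 0) :
    preCoord i (y, t) ∈ realSub n := by
  intro j
  by_cases h : j = i
  · simp only [preCoord, h, if_true]
    rw [exists_ofReal_mul_pow ht (hy i), Complex.ofReal_im]
  · have h2 : y i = ((y i).re : ℂ) := Complex.ext rfl (by simpa using hy i)
    simp only [preCoord, h, if_false]
    rw [h2, Complex.div_ofReal_im, hy j, zero_div]

theorem affVec_mem_realSub (i : Fin n) {w : E n} (hw : w ∈ realSub n) :
    affVec i w ∈ realSub n := by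
  intro j
  by_cases h : j = i
  · simp [h]
  · simp [affVec, h, hw j]

theorem mk_linChart {M : E n ≃L[ℂ] E n} {i : Fin n} {x : K n} (hx : x ∈ (linChart M i).source) :
    K.mk ⟨(M (affVec i (linChart M i x)), linChart M i x i),
      by simpa using affVec_ne_zero i _⟩ = x :=
  (linChart M i).left_inv hx

theorem mem_fullLift_iff {M : E n ≃L[ℂ] E n} {i : Fin n} {x : K n}
    (hx : x ∈ (linChart M i).source) : x ∈ fullLift M ↔ linChart M i x ∈ realSub n := by
  constructor
  · rintro ⟨p, rfl, h1, h2⟩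
    rw [linChart_mk]
    exact preCoord_mem_realSub i h1 h2
  · intro h
    refine ⟨_, mk_linChart hx, ?_, h i⟩
    dsimp only
    rw [M.symm_apply_apply]
    exact affVec_mem_realSub i h

/-- For even n the factor yᵢⁿ is nonnegative, so the sign condition on t survives in the coordinate
t yᵢⁿ. -/
theorem mem_halfLift_iff (hn : Even n) {M : E n ≃L[ℂ] E n} {i : Fin n} {x : K n}
    (hx : x ∈ (linChart M i).source) :
    x ∈ halfLift M ↔ linChart M i x ∈ realSub n ∧ 0 ≤ (linChart M i x i).re := by
  constructor
  · rintro ⟨p, rfl, h1, h2, h3⟩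
    rw [linChart_mk]
    refine ⟨preCoord_mem_realSub i h1 h2, ?_⟩
    simp only [preCoord, if_true]
    rw [exists_ofReal_mul_pow h2 (h1 i), Complex.ofReal_re]
    exact mul_nonneg h3 (hn.pow_nonneg _)
  · rintro ⟨h, h'⟩
    refine ⟨_, mk_linChart hx, ?_, h i, h'⟩
    dsimp only
    rw [M.symm_apply_apply]
    exact affVec_mem_realSub i h

theorem mem_excDiv_iff {M : E n ≃L[ℂ] E n} {i : Fin n} {x : K n}
    (hx : x ∈ (linChart M i).source) : x ∈ excDiv n ↔ linChart M i x i = 0 := by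
  constructor
  · rintro ⟨p, rfl, h⟩
    rw [linChart_mk]
    simp [preCoord, h]
  · exact fun h => ⟨_, mk_linChart hx, h⟩

/-- Closedness is local, and the adapted charts cover K. -/
theorem isClosed_of_linChart {M : E n ≃L[ℂ] E n} {S : Set (K n)} {C : Fin n → Set (E n)}
    (hC : ∀ i, IsClosed (C i)) (h : ∀ i, ∀ x ∈ (linChart M i).source, x ∈ S ↔ linChart M i x ∈ C i) :
    IsClosed S := by
  rw [← isOpen_compl_iff, isOpen_iff_mem_nhds]
  intro x hx
  obtain ⟨i, hi⟩ := exists_mem_linChart_source M x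
  have h1 : linChart M i x ∈ (C i)ᶜ := fun hc => hx ((h i x hi).2 hc)
  filter_upwards [(linChart M i).open_source.mem_nhds hi,
    ((linChart M i).continuousAt hi).preimage_mem_nhds ((hC i).isOpen_compl.mem_nhds h1)]
    with y hy1 hy2 hy
  exact hy2 ((h i y hy1).1 hy)

theorem isClosed_fullLift (M : E n ≃L[ℂ] E n) : IsClosed (fullLift M) :=
  isClosed_of_linChart (fun _ => isClosed_realSub n) fun _ _ hx => mem_fullLift_iff hx

theorem isClosed_halfLift (M : E n ≃L[ℂ] E n) : IsClosed (halfLift M) := by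
  rcases Nat.even_or_odd n with hn | hn
  · refine isClosed_of_linChart (C := fun i => {w | w ∈ realSub n ∧ 0 ≤ (w i).re}) (fun i => ?_)
      fun i x hx => mem_halfLift_iff hn hx
    have h : Continuous fun w : E n => (w i).re := by fun_prop
    exact (isClosed_realSub n).inter (isClosed_le continuous_const h)
  · rw [halfLift_eq_fullLift hn]
    exact isClosed_fullLift M

theorem mk_eq_lift_smul [NeZero n] {z : E n} (hz : z ≠ 0) {l : ℂ} (hl : l ≠ 0) :
    K.mk ⟨(z, l ^ n), hz⟩ = lift (l • z) := by
  rw [lift_of_ne (smul_ne_zero hl hz)]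
  exact K.mk_eq_iff.2 ⟨l, hl, rfl, by simp⟩

theorem mk_mem_closure_of_forall {S : Set (K n)} {z : E n} (hz : z ≠ 0) (t c : ℂ)
    (h : ∀ s : ℝ, 0 < s → K.mk ⟨(z, t + s * c), hz⟩ ∈ S) : K.mk ⟨(z, t), hz⟩ ∈ closure S := by
  have hc : Continuous fun s : ℝ => K.mk (⟨(z, t + s * c), hz⟩ : PreK n) := by
    refine (K.isQuotientMap_mk n).continuous.comp (Continuous.subtype_mk ?_ _)
    fun_prop
  have h1 : Tendsto (fun s : ℝ => K.mk (⟨(z, t + s * c), hz⟩ : PreK n)) (𝓝[>] 0)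
      (𝓝 (K.mk ⟨(z, t), hz⟩)) := by
    have := (hc.tendsto 0).mono_left (nhdsWithin_le_nhds (s := Ioi 0))
    simpa using this
  exact mem_closure_of_tendsto h1 (eventually_mem_nhdsWithin.mono h)

/-- For t > 0 a real root r of t gives t z^{⊗n} = (rz)^{⊗n} with rz in Q. Replacing t by t + s with
s > 0 includes t = 0 as a limit. -/
theorem halfLift_subset_closure [NeZero n] {Q : Submodule ℝ (E n)} {M : E n ≃L[ℂ] E n}
    (hQ : ∀ z, z ∈ Q ↔ M.symm z ∈ realSub n) : halfLift M ⊆ closure (lift '' (Q \ {0})) := by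
  rintro _ ⟨⟨⟨z, t⟩, hz⟩, rfl, h1, h2, h3⟩
  refine mk_mem_closure_of_forall hz t 1 fun s hs => ?_
  have hr : ((t.re + s) ^ ((n : ℝ)⁻¹)) ^ n = t.re + s :=
    Real.rpow_inv_natCast_pow (by dsimp only at h3; positivity) (NeZero.ne n)
  generalize (t.re + s) ^ ((n : ℝ)⁻¹) = r at hr
  have ht : t + s * 1 = (r : ℂ) ^ n := by
    rw [← Complex.ofReal_pow, hr]
    apply Complex.ext <;> simp
    exact h2
  have hr0 : (r : ℂ) ≠ 0 := by
    have : 0 < t.re + s := by dsimp only at h3; positivity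
    rw [← hr] at this
    norm_cast
    rintro rfl
    simp [NeZero.ne n] at this
  simp only [ht]
  rw [mk_eq_lift_smul hz hr0]
  exact mem_image_of_mem _ ⟨Q.smul_mem r ((hQ z).2 h1), smul_ne_zero hr0 hz⟩

theorem exp_pi_div_pow [NeZero n] : Complex.exp (Real.pi / n * Complex.I) ^ n = -1 := by
  have hn : (n : ℂ) ≠ 0 := by exact_mod_cast NeZero.ne n
  rw [← Complex.exp_nat_mul, ← Complex.exp_pi_mul_I]
  congr 1
  field_simp

theorem lifted_eq_halfLift [NeZero n] {Q : Submodule ℝ (E n)} {M : E n ≃L[ℂ] E n}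
    (hQ : ∀ z, z ∈ Q ↔ M.symm z ∈ realSub n) : lifted Q = halfLift M := by
  rw [lifted, strictTransform_eq]
  refine (closure_minimal ?_ (isClosed_halfLift M)).antisymm (halfLift_subset_closure hQ)
  rintro _ ⟨z, ⟨hz, hz0⟩, rfl⟩
  exact ⟨_, (lift_of_ne hz0).symm, (hQ z).1 hz, by simp, by simp⟩

theorem doubled_eq_fullLift [NeZero n] {Q : Submodule ℝ (E n)} {M : E n ≃L[ℂ] E n}
    (hQ : ∀ z, z ∈ Q ↔ M.symm z ∈ realSub n) : doubled Q = fullLift M := by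
  have he0 := Complex.exp_ne_zero (Real.pi / n * Complex.I)
  have hen := exp_pi_div_pow (n := n)
  rw [doubled, strictTransform_eq]
  generalize Complex.exp (Real.pi / n * Complex.I) = e at he0 hen
  refine (closure_minimal ?_ (isClosed_fullLift M)).antisymm ?_
  · rintro _ ⟨z, ⟨hz | ⟨v, hv, rfl⟩, hz0⟩, rfl⟩
    · exact ⟨_, (lift_of_ne hz0).symm, (hQ z).1 hz, by simp⟩
    · have hv0 : v ≠ 0 := by rintro rfl; simp at hz0
      refine ⟨⟨(v, e ^ n), hv0⟩, mk_eq_lift_smul hv0 he0, (hQ v).1 hv, ?_⟩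
      simp [hen]
  · rintro _ ⟨⟨⟨z, t⟩, hz⟩, rfl, h1, h2⟩
    rcases le_total 0 t.re with h3 | h3
    · exact closure_mono (image_mono (sdiff_subset_sdiff_left subset_union_left))
        (halfLift_subset_closure hQ ⟨_, rfl, h1, h2, h3⟩)
    -- Negative t come from the rotated plane: t - s is (er)ⁿ with r real, because eⁿ = -1.
    · refine mk_mem_closure_of_forall hz t (-1) fun s hs => ?_
      have hts : 0 < -t.re + s := by linarith
      have hr : ((-t.re + s) ^ ((n : ℝ)⁻¹)) ^ n = -t.re + s :=
        Real.rpow_inv_natCast_pow hts.le (NeZero.ne n)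
      generalize (-t.re + s) ^ ((n : ℝ)⁻¹) = r at hr
      have ht : t + s * -1 = (e * r) ^ n := by
        rw [mul_pow, hen, ← Complex.ofReal_pow, hr]
        refine Complex.ext ?_ ?_
        · simp
          ring
        · simpa using h2
      have hr0 : (r : ℂ) ≠ 0 := by
        rw [← hr] at hts
        norm_cast
        rintro rfl
        simp [NeZero.ne n] at hts
      simp only [ht]
      rw [mk_eq_lift_smul hz (mul_ne_zero he0 hr0)]
      refine mem_image_of_mem _ ⟨Or.inr ⟨(r : ℂ) • z, Q.smul_mem r ((hQ z).2 h1), ?_⟩,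
        smul_ne_zero (mul_ne_zero he0 hr0) hz⟩
      exact smul_smul _ _ _

theorem isSubmanifold_fullLift (M : E n ≃L[ℂ] E n) : IsSubmanifold (fullLift M) ∅ where
  boundary_subset := empty_subset _
  interior x _ _ := by
    obtain ⟨i, hi⟩ := exists_mem_linChart_source M x
    exact ⟨_, linChart_mem_maximalAtlas M i, hi, realSub n, finrank_realSub n,
      fun y hy => mem_fullLift_iff hy⟩
  boundary x hx := hx.elim

theorem isSubmanifold_halfLift (M : E n ≃L[ℂ] E n) :
    IsSubmanifold (halfLift M) {x | Even n ∧ x ∈ halfLift M ∧ x ∈ excDiv n} := by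
  rcases Nat.even_or_odd n with hn | hn
  swap
  · have : {x | Even n ∧ x ∈ halfLift M ∧ x ∈ excDiv n} = ∅ := by
      ext x
      simp [Nat.not_even_iff_odd.2 hn]
    rw [this, halfLift_eq_fullLift hn]
    exact isSubmanifold_fullLift M
  refine ⟨fun x hx => hx.2.1, fun x hx hxB => ?_, fun x hx => ?_⟩
  · obtain ⟨i, hi⟩ := exists_mem_linChart_source M x
    -- Off the divisor wᵢ > 0; shrinking the chart to this open set makes the inequality automatic,
    -- leaving a full real subspace.
    have hopen : IsOpen ((linChart M i).source ∩ linChart M i ⁻¹' {w | 0 < (w i).re}) := by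
      refine (linChart M i).isOpen_inter_preimage (isOpen_lt continuous_const ?_)
      fun_prop
    have hsrc : ((linChart M i).restr _).source = _ := (linChart M i).restr_source' _ hopen
    have hx' := (mem_halfLift_iff hn hi).1 hx
    have hne : linChart M i x i ≠ 0 := fun h => hxB ⟨hn, hx, (mem_excDiv_iff hi).2 h⟩
    have hpos : 0 < (linChart M i x i).re :=
      hx'.2.lt_of_ne fun h => hne (Complex.ext h.symm (hx'.1 i))
    refine ⟨(linChart M i).restr _, restr_mem_maximalAtlas _ (linChart_mem_maximalAtlas M i) hopen,
      ?_, realSub n, finrank_realSub n, fun y hy => ?_⟩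
    · rw [hsrc]
      exact ⟨hi, hi, hpos⟩
    · rw [hsrc] at hy
      have hy0 : 0 < (linChart M i y i).re := hy.2.2
      rw [mem_halfLift_iff hn hy.1]
      exact and_iff_left hy0.le
  · obtain ⟨i, hi⟩ := exists_mem_linChart_source M x
    refine ⟨_, linChart_mem_maximalAtlas M i, hi, realSub n, finrank_realSub n,
      Complex.reCLM ∘L (PiLp.proj 2 (fun _ : Fin n => ℂ) i : E n →L[ℝ] ℂ), ?_, ?_, fun y hy => ?_⟩
    · refine ⟨EuclideanSpace.single i 1, fun j => ?_, by simp⟩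
      by_cases h : j = i
      · simp [h]
      · simp [h]
    · simp [(mem_excDiv_iff hi).1 hx.2.2]
    · exact mem_halfLift_iff hn hy

end Strict

/-! ### Tangent spaces of the lifts -/

section Tangent

theorem tangentConeAt_submodule {V : Type*} [NormedAddCommGroup V] [NormedSpace ℝ V]
    [FiniteDimensional ℝ V] (W : Submodule ℝ V) {p : V} (hp : p ∈ W) :
    tangentConeAt ℝ (W : Set V) p = W := by
  ext y
  constructor
  · intro h
    obtain ⟨α, l, hl, c, d, -, hds, hcd⟩ := exists_fun_of_mem_tangentConeAt h
    refine W.closed_of_finiteDimensional.mem_of_tendsto hcd (hds.mono fun k hk => ?_)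
    exact W.smul_mem _ ((W.add_mem_iff_right hp).1 hk)
  · intro hy
    have hc : Tendsto (fun c : ℝ => c) (𝓝[≠] 0) (𝓝[≠] 0) := tendsto_id
    exact mem_tangentConeAt_of_add_smul_mem hc
      (Eventually.of_forall fun c => W.add_mem hp (W.smul_mem c hy))

variable {n : ℕ}

theorem eventually_apply_ne_zero {f : E n → E n} {w : E n} (hf : ContinuousAt f w) {j : Fin n}
    (hw : f w j ≠ 0) : ∀ᶠ w' in 𝓝 w, f w' j ≠ 0 := by
  have h2 : Continuous fun v : E n => v j := by fun_prop
  exact (h2.continuousAt.comp hf).eventually_ne hw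

/-- Tangent vectors of the lift of `M ℝⁿ` are real in the coordinates adapted to `M`. -/
theorem fderiv_transCoord_mem_realSub {M : E n ≃L[ℂ] E n} {S : Set (K n)} (hS : S ⊆ fullLift M)
    {x : K n} (hx : x ∈ S) {i : Fin n} (hi : x ∈ (linChart M i).source)
    {X : TangentSpace 𝓘(ℝ, E n) x} (hX : X ∈ tangent S x) :
    (fderiv ℝ (transCoord M.symm (chartIdx x) i) (coord (chartIdx x) x) X : E n) ∈ realSub n := by
  set j := chartIdx x with hj
  set w := coord j x with hw
  have hxw : coordInv j w = x := coordInv_coord (mem_dom_chartIdx x)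
  have hwi : M.symm (affVec j w) i ≠ 0 := by
    rw [← hxw] at hi
    exact mk_mem_linChart_source.1 hi
  have hT := ((contDiffAt_transCoord ℝ 1 M.symm j i hwi).differentiableAt one_ne_zero).hasFDerivAt
  have hnhds : {w' | M.symm (affVec j w') i ≠ 0} ∈ 𝓝 w :=
    eventually_apply_ne_zero (M.symm.continuous.comp
      (contDiff_affVec ℂ 0 j).continuous).continuousAt hwi
  have hmaps : ∀ w', coordInv j w' ∈ S → M.symm (affVec j w') i ≠ 0 →
      transCoord M.symm j i w' ∈ realSub n := fun w' h1 h2 =>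
    (mem_fullLift_iff (mk_mem_linChart_source.2 h2)).1 (hS h1)
  have hle : tangent S x ≤ (realSub n).comap
      (fderiv ℝ (transCoord M.symm j i) w : E n →L[ℝ] E n).toLinearMap := by
    -- The derivative of the coordinate change carries the tangent cone into that of the image,
    -- which lies in the real subspace, and a subspace is its own tangent cone.
    refine Submodule.span_le.2 fun Y hY => ?_
    change Y ∈ tangentConeAt ℝ (coord j '' (S ∩ dom j)) w at hY
    rw [← tangentConeAt_inter_nhds hnhds] at hY
    have h1 := (hT.hasFDerivWithinAt (s := coord j '' (S ∩ dom j) ∩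
      {w' | M.symm (affVec j w') i ≠ 0})).mapsTo_tangent_cone hY
    have h2 : transCoord M.symm j i '' (coord j '' (S ∩ dom j) ∩
        {w' | M.symm (affVec j w') i ≠ 0}) ⊆ (realSub n : Set (E n)) := by
      rintro _ ⟨_, ⟨⟨y, ⟨hyS, hyj⟩, rfl⟩, h⟩, rfl⟩
      exact hmaps _ (by rwa [coordInv_coord hyj]) h
    have h3 := tangentConeAt_mono h2 h1
    rwa [tangentConeAt_submodule _ (hmaps w (by rwa [hxw]) hwi)] at h3
  exact hle hX

/-- The special condition of phase `θ` on a plane in `ℂⁿ`. -/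
def IsPhase (Q : Submodule ℝ (E n)) (θ : ℝ) : Prop :=
  ∀ X : Fin n → E n, (∀ k, X k ∈ Q) → (Complex.exp (θ * Complex.I) * detForm n X).im = 0

theorem detForm_single : detForm n (fun k => EuclideanSpace.single k 1) = 1 := by
  rw [detForm_apply, ← Matrix.det_one (n := Fin n)]
  congr 1
  ext j k
  simp [Matrix.one_apply]

/-- Vectors of Q are M applied to real vectors, so dz₁ ∧ … ∧ dzₙ on Q is det M times a real
determinant; the images of the standard basis attain det M. -/
theorem isPhase_iff {Q : Submodule ℝ (E n)} {M : E n ≃L[ℂ] E n}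
    (hQ : ∀ z, z ∈ Q ↔ M.symm z ∈ realSub n) (θ : ℝ) :
    IsPhase Q θ ↔
      (Complex.exp (θ * Complex.I) * LinearMap.det (M : E n →ₗ[ℂ] E n)).im = 0 := by
  constructor
  · intro h
    have := h (fun k => M (EuclideanSpace.single k 1)) fun k => by
      rw [hQ, M.symm_apply_apply]
      intro j
      by_cases h : j = k <;> simp [h]
    have h2 := detForm_map (M : E n →ₗ[ℂ] E n) fun k => EuclideanSpace.single k 1
    rw [detForm_single, mul_one] at h2
    rwa [← h2]
  · intro h X hX
    have h2 := detForm_map (M : E n →ₗ[ℂ] E n) fun k => M.symm (X k)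
    have h3 := detForm_im_of_real fun k => (hQ _).1 (hX k)
    have h4 : (fun k => (M : E n →ₗ[ℂ] E n) (M.symm (X k))) = X :=
      funext fun k => M.apply_symm_apply _
    rw [h4] at h2
    rw [h2, ← mul_assoc, Complex.mul_im, h, h3, mul_zero, zero_mul, add_zero]

variable [NeZero n]

/-- It supplies enough tangent vectors at one lifted point to recover the phase of Q from the phase
of S. -/
theorem fderiv_liftCoord_mem_tangent {Q : Submodule ℝ (E n)} {S : Set (K n)}
    (hS : lift '' (Q \ {0}) ⊆ S) {z : E n} (hz : z ∈ Q) (hz0 : z ≠ 0) {v : E n} (hv : v ∈ Q) :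
    (fderiv ℝ (liftCoord (chartIdx (lift z))) z v : E n) ∈ tangent S (lift z) := by
  set j := chartIdx (lift z) with hj
  have hzj : z j ≠ 0 := by
    have := mem_dom_chartIdx (lift z)
    rw [lift_of_ne hz0, mk_mem_dom, ← lift_of_ne hz0] at this
    exact this
  refine Submodule.subset_span ?_
  change fderiv ℝ (liftCoord j) z v ∈ tangentConeAt ℝ (coord j '' (S ∩ dom j)) (coord j (lift z))
  have hcl : ∀ z' : E n, z' j ≠ 0 → coord j (lift z') = liftCoord j z' := fun z' h => by
    rw [lift_eq_coordInv h, coord_coordInv]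
  have h1 : v ∈ tangentConeAt ℝ ((Q : Set (E n)) ∩ {z' | z' j ≠ 0}) z := by
    have hnhds : {z' : E n | z' j ≠ 0} ∈ 𝓝 z := eventually_apply_ne_zero continuousAt_id hzj
    rw [tangentConeAt_inter_nhds hnhds, tangentConeAt_submodule Q hz]
    exact hv
  have hT := ((contDiffAt_liftCoord ℝ 1 j hzj).differentiableAt one_ne_zero).hasFDerivAt
  have h2 := (hT.hasFDerivWithinAt (s := (Q : Set (E n)) ∩ {z' | z' j ≠ 0})).mapsTo_tangent_cone h1
  rw [hcl z hzj]
  refine tangentConeAt_mono ?_ h2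
  rintro _ ⟨z', ⟨hz', hj'⟩, rfl⟩
  have h0 : z' ≠ 0 := by
    rintro rfl
    exact hj' rfl
  refine ⟨lift z', ⟨hS (mem_image_of_mem _ ⟨hz', h0⟩), ?_⟩, hcl z' hj'⟩
  rw [lift_of_ne h0]
  exact mk_mem_dom.2 hj'

/-- Only S ⊆ `fullLift` matters: tangent vectors are then real in the adapted chart, so half lifts
are covered at boundary points too. By unitary invariance the form has its usual expression in that
chart. -/
theorem isLagrangian_of_subset {η : TwoForm n} (hη : IsCalabiForm η) (M : E n ≃ₗᵢ[ℂ] E n)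
    {S B : Set (K n)} (hS : S ⊆ fullLift M.toContinuousLinearEquiv) (hSB : IsSubmanifold S B) :
    IsLagrangian η S B := by
  refine ⟨hSB, fun x hx X hX Y hY => ?_⟩
  obtain ⟨i, hi⟩ := exists_mem_linChart_source M.toContinuousLinearEquiv x
  have hX' := fderiv_transCoord_mem_realSub hS hx hi hX
  have hY' := fderiv_transCoord_mem_realSub hS hx hi hY
  have hxw : coordInv (chartIdx x) (coord (chartIdx x) x) = x := coordInv_coord (mem_dom_chartIdx x)
  have hreal : transCoord M.toContinuousLinearEquiv.symm (chartIdx x) i (coord (chartIdx x) x) ∈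
      realSub n := by
    have h : transCoord M.toContinuousLinearEquiv.symm (chartIdx x) i (coord (chartIdx x) x) =
        linChart M.toContinuousLinearEquiv i x :=
      congrArg (linChart M.toContinuousLinearEquiv i) hxw
    rw [h]
    exact (mem_fullLift_iff hi).1 (hS hx)
  have hwi : M.toContinuousLinearEquiv.symm (affVec (chartIdx x) (coord (chartIdx x) x)) i ≠ 0 := by
    have := hi
    rw [← hxw] at this
    exact mk_mem_linChart_source.1 this
  have h := coordForm_transCoord (NeZero.ne n) (fun i => (contDiff_calabiCoord i).continuous)
    (fun i z hz X => calabiCoord_liftCoord (NeZero.ne n) hz X) M.toContinuousLinearEquiv.symm 1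
    (fun z _ X => by rw [one_mul]; exact calabiReal_map M.symm z X) (chartIdx x) i hwi ![X, Y]
  rw [calabiCoord_eq_zero_of_real i hreal, one_mul] at h
  · change KForm.val (𝕜 := ℝ) η x ![X, Y] = 0
    rw [KForm.val_eq_inChart, isCalabiForm_inChart hη]
    exact h.symm
  · intro k
    fin_cases k
    · exact hX'
    · exact hY'

/-- In the adapted chart Ω is det M times n⁻¹ dw₁ ∧ … ∧ dwₙ, and the latter is real on real vectors.
-/
theorem volume_im_eq_zero {Φ : TopForm n} (hΦ : IsVolumeForm Φ) {M : E n ≃L[ℂ] E n}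
    {S : Set (K n)} (hS : S ⊆ fullLift M) {x : K n} (hx : x ∈ S) {c : ℂ}
    (hc : (c * LinearMap.det (M : E n →ₗ[ℂ] E n)).im = 0)
    {X : Fin n → TangentSpace 𝓘(ℝ, E n) x} (hX : ∀ k, X k ∈ tangent S x) :
    (c * Φ x X).im = 0 := by
  obtain ⟨i, hi⟩ := exists_mem_linChart_source M x
  have hX' := fun k => fderiv_transCoord_mem_realSub hS hx hi (hX k)
  have hxw : coordInv (chartIdx x) (coord (chartIdx x) x) = x := coordInv_coord (mem_dom_chartIdx x)
  have hwi : M.symm (affVec (chartIdx x) (coord (chartIdx x) x)) i ≠ 0 := by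
    have := hi
    rw [← hxw] at this
    exact mk_mem_linChart_source.1 this
  have h := coordForm_transCoord (𝕜 := ℂ) (NeZero.ne n)
    (c := fun _ _ => (n : ℂ)⁻¹ • detForm n) (fun _ => continuous_const)
    (σ := fun _ X => detForm n X)
    (fun i z hz X => volumeCoord_liftCoord (NeZero.ne n) hz X) M.symm
    (LinearMap.det (M.symm : E n →ₗ[ℂ] E n))
    (fun z _ X => detForm_map _ X) (chartIdx x) i hwi X
  have hD : ∀ k, (fderiv ℂ (transCoord M.symm (chartIdx x) i) (coord (chartIdx x) x) (X k) : E n) =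
      fderiv ℝ (transCoord M.symm (chartIdx x) i) (coord (chartIdx x) x) (X k) := by
    intro k
    rw [((contDiffAt_transCoord ℂ 1 M.symm (chartIdx x) i hwi).differentiableAt
      one_ne_zero).fderiv_restrictScalars ℝ]
    rfl
  have hr : (((n : ℂ)⁻¹ • detForm n) fun k =>
      (fderiv ℂ (transCoord M.symm (chartIdx x) i) (coord (chartIdx x) x) (X k) : E n)).im = 0 := by
    have h1 := detForm_im_of_real hX'
    rw [ContinuousAlternatingMap.smul_apply, funext hD, smul_eq_mul, ← Complex.ofReal_natCast,
      ← Complex.ofReal_inv, Complex.im_ofReal_mul, h1, mul_zero]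
  have hdet : LinearMap.det (M : E n →ₗ[ℂ] E n) * LinearMap.det (M.symm : E n →ₗ[ℂ] E n) = 1 := by
    rw [← LinearMap.det_comp]
    have : (M : E n →ₗ[ℂ] E n) ∘ₗ (M.symm : E n →ₗ[ℂ] E n) = LinearMap.id := by
      ext1 v
      exact M.apply_symm_apply v
    rw [this, LinearMap.det_id]
  have hΦx : Φ x X = ((n : ℂ)⁻¹ • detForm n) X := by
    change KForm.val (𝕜 := ℂ) Φ x X = _
    rw [KForm.val_eq_inChart, isVolumeForm_inChart hΦ]
  have hfin : c * Φ x X = c * LinearMap.det (M : E n →ₗ[ℂ] E n) * (((n : ℂ)⁻¹ • detForm n) fun k =>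
      (fderiv ℂ (transCoord M.symm (chartIdx x) i) (coord (chartIdx x) x) (X k) : E n)) := by
    rw [hΦx]
    refine Eq.trans ?_ (congrArg (c * LinearMap.det (M : E n →ₗ[ℂ] E n) * ·) h.symm)
    rw [mul_assoc, ← mul_assoc (LinearMap.det _), hdet, one_mul]
  rw [hfin, Complex.mul_im, hc, hr, mul_zero, zero_mul, add_zero]

/-- One point suffices for the forward direction: at the lift of a nonzero z in Q, Ω on lifted
vectors is their determinant in ℂⁿ. -/
theorem isSpecialLagrangian_iff {η : TwoForm n} {Φ : TopForm n} (hΦ : IsVolumeForm Φ)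
    {Q : Submodule ℝ (E n)} {M : E n ≃L[ℂ] E n} (hQ : ∀ z, z ∈ Q ↔ M.symm z ∈ realSub n)
    {S B : Set (K n)} (hS : S ⊆ fullLift M) (hQS : lift '' (Q \ {0}) ⊆ S)
    (hL : IsLagrangian η S B) (θ : ℝ) : IsSpecialLagrangian η Φ θ S B ↔ IsPhase Q θ := by
  constructor
  · rintro ⟨-, h⟩ X hX
    set z : E n := M (EuclideanSpace.single 0 1) with hz
    have hzQ : z ∈ Q := by
      rw [hQ, hz, M.symm_apply_apply]
      intro j
      by_cases h : j = 0 <;> simp [h]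
    have hz0 : z ≠ 0 := by simp [hz]
    have h1 := h (lift z) (hQS (mem_image_of_mem _ ⟨hzQ, hz0⟩))
      (fun k => fderiv ℝ (liftCoord (chartIdx (lift z))) z (X k))
      fun k => fderiv_liftCoord_mem_tangent hQS hzQ hz0 (hX k)
    have hzj : z (chartIdx (lift z)) ≠ 0 := by
      have := mem_dom_chartIdx (lift z)
      rw [lift_of_ne hz0, mk_mem_dom, ← lift_of_ne hz0] at this
      exact this
    have h2 : KForm.val (𝕜 := ℂ) Φ (lift z)
        (fun k => fderiv ℝ (liftCoord (chartIdx (lift z))) z (X k)) = detForm n X := by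
      rw [KForm.val_eq_inChart, isVolumeForm_inChart hΦ,
        ← volumeCoord_liftCoord (NeZero.ne n) hzj X]
      congr 1
      funext k
      rw [((contDiffAt_liftCoord ℂ 1 _ hzj).differentiableAt
        one_ne_zero).fderiv_restrictScalars ℝ]
      rfl
    rw [← h2]
    exact h1
  · exact fun h => ⟨hL, fun x hx X hX => volume_im_eq_zero hΦ hS hx ((isPhase_iff hQ θ).1 h) hX⟩

/-- The lifts of a plane that is the image of `ℝⁿ` under a unitary map are Lagrangian, and special
with the phases of the plane. -/
theorem lifts_of_unitary {η : TwoForm n} {Φ : TopForm n} (hη : IsCalabiForm η)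
    (hΦ : IsVolumeForm Φ) {Q : Submodule ℝ (E n)} (M : E n ≃ₗᵢ[ℂ] E n)
    (hQ : ∀ z, z ∈ Q ↔ M.symm z ∈ realSub n) :
    IsLagrangian η (lifted Q) (liftedBoundary Q) ∧ IsLagrangian η (doubled Q) ∅ ∧
      (∀ θ : ℝ, IsSpecialLagrangian η Φ θ (lifted Q) (liftedBoundary Q) ↔ IsPhase Q θ) ∧
      ∀ θ : ℝ, IsSpecialLagrangian η Φ θ (doubled Q) ∅ ↔ IsPhase Q θ := by
  have hQ' : ∀ z, z ∈ Q ↔ M.toContinuousLinearEquiv.symm z ∈ realSub n := hQ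
  have h1 := lifted_eq_halfLift hQ'
  have h2 := doubled_eq_fullLift hQ'
  have hs1 : lifted Q ⊆ fullLift M.toContinuousLinearEquiv := by
    rw [h1]
    exact halfLift_subset_fullLift _
  have hs2 : doubled Q ⊆ fullLift M.toContinuousLinearEquiv := h2.subset
  have hl1 : lift '' (Q \ {0}) ⊆ lifted Q := by
    rw [lifted, strictTransform_eq]
    exact subset_closure
  have hl2 : lift '' (Q \ {0}) ⊆ doubled Q := by
    rw [doubled, strictTransform_eq]
    exact (image_mono (sdiff_subset_sdiff_left subset_union_left)).trans subset_closure
  have hL1 : IsLagrangian η (lifted Q) (liftedBoundary Q) := by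
    refine isLagrangian_of_subset hη M hs1 ?_
    rw [liftedBoundary, h1]
    exact isSubmanifold_halfLift _
  have hL2 : IsLagrangian η (doubled Q) ∅ := by
    refine isLagrangian_of_subset hη M hs2 ?_
    rw [h2]
    exact isSubmanifold_fullLift _
  exact ⟨hL1, hL2, isSpecialLagrangian_iff hΦ hQ' hs1 hl1 hL1,
    isSpecialLagrangian_iff hΦ hQ' hs2 hl2 hL2⟩

end Tangent

/-! ### Lagrangian planes and their phases -/

section Planes

variable {n : ℕ}

theorem exists_unitary {Q : Submodule ℝ (E n)} (hQ : Module.finrank ℝ Q = n)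
    (hL : ∀ x ∈ Q, ∀ y ∈ Q, (inner ℂ x y).im = 0) :
    ∃ M : E n ≃ₗᵢ[ℂ] E n, ∀ z, z ∈ Q ↔ M.symm z ∈ realSub n := by
  let b := (stdOrthonormalBasis ℝ Q).reindex (finCongr hQ)
  let v : Fin n → E n := fun k => b k
  have hre : ∀ x y : E n, (inner ℂ x y).re = inner ℝ x y := fun x y => by
    simp [PiLp.inner_apply, Complex.inner]
  -- The real part of the Hermitian product is the Euclidean one and the imaginary part vanishes on
  -- Q, so real orthonormality is unitary orthonormality.
  have hon : Orthonormal ℂ v := by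
    rw [orthonormal_iff_ite]
    intro k l
    have h1 := orthonormal_iff_ite.1 b.orthonormal k l
    have h2 : (inner ℂ (v k) (v l)).re = if k = l then 1 else 0 := (hre _ _).trans h1
    have h3 := hL (v k) (b k).2 (v l) (b l).2
    apply Complex.ext
    · rw [h2]; split_ifs <;> rfl
    · rw [h3]; split_ifs <;> rfl
  have hsp : ⊤ ≤ Submodule.span ℂ (range v) :=
    (hon.linearIndependent.span_eq_top_of_card_eq_finrank' (by simp)).ge
  let B := OrthonormalBasis.mk hon hsp
  have hB : ∀ k, B k = v k := fun k => by simp [B]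
  refine ⟨B.repr.symm, fun z => ⟨fun hz k => ?_, fun hz => ?_⟩⟩
  · have : B.repr z k = inner ℂ (v k) z := by rw [B.repr_apply_apply, hB]
    exact (congrArg Complex.im this).trans (hL _ (b k).2 _ hz)
  · rw [← B.sum_repr z]
    refine Q.sum_mem fun k _ => ?_
    have : B.repr z k = ((B.repr z k).re : ℂ) := Complex.ext rfl (by simpa using hz k)
    rw [this, hB]
    exact Q.smul_mem (B.repr z k).re (b k).2

variable (A : Matrix (Fin n) (Fin n) ℝ)

/-- The plane `x = A y`, parametrized by `y`. -/
def planeEquiv : (Fin n → ℝ) ≃ₗ[ℝ] plane A where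
  toFun y := ⟨WithLp.toLp 2 fun i => ⟨∑ j, A i j * y j, y i⟩, fun i => rfl⟩
  map_add' x y := by
    ext j
    apply Complex.ext <;> simp [mul_add, Finset.sum_add_distrib]
  map_smul' c y := by
    ext j
    apply Complex.ext <;> simp [Finset.mul_sum, mul_left_comm]
  invFun w j := (w.1 j).im
  left_inv y := rfl
  right_inv w := by
    ext j
    exact Complex.ext (w.2 j).symm rfl

theorem finrank_plane : Module.finrank ℝ (plane A) = n := by
  rw [← (planeEquiv A).finrank_eq, Module.finrank_fin_fun]

variable {A} in
theorem inner_im_eq_zero_of_plane (hA : A.IsSymm) {x y : E n} (hx : x ∈ plane A)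
    (hy : y ∈ plane A) : (inner ℂ x y).im = 0 := by
  have h : (inner ℂ x y).im =
      ∑ i, (∑ j, A i j * (x j).im) * (y i).im - ∑ i, (x i).im * ∑ j, A i j * (y j).im := by
    rw [PiLp.inner_apply, Complex.im_sum, ← Finset.sum_sub_distrib]
    refine Finset.sum_congr rfl fun i _ => ?_
    rw [← hx i, ← hy i]
    simp
    ring
  have h2 : ∑ i, (∑ j, A i j * (x j).im) * (y i).im = ∑ i, (x i).im * ∑ j, A i j * (y j).im := by
    simp only [Finset.sum_mul, Finset.mul_sum]
    rw [Finset.sum_comm]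
    refine Finset.sum_congr rfl fun i _ => Finset.sum_congr rfl fun j _ => ?_
    rw [← hA.apply i j]
    ring
  rw [h, h2, sub_self]

/-- The matrix `A + √-1`. -/
def addI : Matrix (Fin n) (Fin n) ℂ := A.map (Complex.ofReal) + Complex.I • 1

/-- The coefficient of Xᵏ in det(1 + XM) is the sum of the principal minors of size k; the degree
bound n makes the sum over all subsets complete. -/
theorem det_one_add_smul_eq_sum {R : Type*} [CommRing R] (M : Matrix (Fin n) (Fin n) R) (r : R) :
    (1 + r • M).det = ∑ S : Finset (Fin n), r ^ S.card *
      (M.submatrix (Subtype.val : S → Fin n) (Subtype.val : S → Fin n)).det := by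
  open Polynomial in
  have h1 : (1 + r • M).det = (Matrix.det (1 + (X : R[X]) • M.map C)).eval r := by
    simp [eval_det, ← Matrix.smul_eq_mul_diagonal]
  have h2 : (Matrix.det (1 + (Polynomial.X : Polynomial R) • M.map Polynomial.C)).natDegree < n + 1 := by
    rw [Nat.lt_succ_iff, Polynomial.natDegree_le_iff_coeff_eq_zero]
    intro N hN
    rw [Matrix.coeff_det_one_add_X_smul_eq_sum_minors, Finset.powersetCard_eq_empty.2 (by simpa),
      Finset.sum_empty]
  rw [h1, Polynomial.eval_eq_sum_range' h2, ← Finset.powerset_univ, Finset.sum_powerset,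
    Finset.card_univ, Fintype.card_fin]
  refine Finset.sum_congr rfl fun k _ => ?_
  rw [Matrix.coeff_det_one_add_X_smul_eq_sum_minors, Finset.sum_mul]
  refine Finset.sum_congr rfl fun S hS => ?_
  rw [(Finset.mem_powersetCard.1 hS).2, mul_comm]

/-- Factor A + √-1 = √-1 (1 - √-1 A); the power iⁿ (-i)ᵏ that results is iⁿ⁻ᵏ. -/
theorem det_addI :
    (addI A).det = ∑ S : Finset (Fin n), Complex.I ^ (n - S.card) * (principalMinor A S : ℂ) := by
  have h : addI A = Complex.I • (1 + (-Complex.I) • A.map Complex.ofReal) := by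
    rw [smul_add, smul_smul]
    simp [addI, add_comm]
  rw [h, Matrix.det_smul, det_one_add_smul_eq_sum, Finset.mul_sum, Fintype.card_fin]
  refine Finset.sum_congr rfl fun S _ => ?_
  have h1 : Complex.I ^ n = Complex.I ^ (n - S.card) * Complex.I ^ S.card := by
    rw [← pow_add, Nat.sub_add_cancel (by simpa using S.card_le_univ)]
  have h2 : Complex.I ^ S.card * (-Complex.I) ^ S.card = 1 := by
    rw [← mul_pow]
    simp
  have h3 : ((A.map Complex.ofReal).submatrix (Subtype.val : S → Fin n) Subtype.val).det =
      (principalMinor A S : ℂ) := by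
    rw [principalMinor]
    exact (RingHom.map_det Complex.ofRealHom _).symm
  rw [h3, h1, mul_assoc, ← mul_assoc (Complex.I ^ S.card), h2, one_mul]

/-- Even powers of i are real and pair with sin θ, odd ones are imaginary and pair with cos θ. -/
theorem phaseSum_eq_im (θ : ℝ) :
    phaseSum A θ = (Complex.exp (θ * Complex.I) * (addI A).det).im := by
  rw [det_addI, Finset.mul_sum, Complex.im_sum, phaseSum, Finset.sum_filter, Finset.sum_filter,
    Finset.mul_sum, Finset.mul_sum, ← Finset.sum_add_distrib]
  refine Finset.sum_congr rfl fun S _ => ?_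
  generalize n - S.card = m
  generalize principalMinor A S = d
  rw [Complex.exp_mul_I, ← Complex.ofReal_cos, ← Complex.ofReal_sin]
  rcases Nat.even_or_odd' m with ⟨p, rfl | rfl⟩
  · have h1 : ¬ Odd (2 * p) := by simp
    have h2 : Complex.I ^ (2 * p) = (((-1) ^ p : ℝ) : ℂ) := by
      rw [pow_mul, Complex.I_sq]
      push_cast
      rfl
    rw [h2, ← Complex.ofReal_mul, Nat.mul_div_cancel_left p two_pos, if_pos (by simp), if_neg h1]
    generalize (-1) ^ p * d = q
    generalize Real.cos θ = c, Real.sin θ = s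
    simp
  · have h1 : ¬ Even (2 * p + 1) := by simp
    have h2 : Complex.I ^ (2 * p + 1) = (((-1) ^ p : ℝ) : ℂ) * Complex.I := by
      rw [pow_succ, pow_mul, Complex.I_sq]
      push_cast
      rfl
    have h3 : (((-1) ^ p : ℝ) : ℂ) * Complex.I * d = (((-1) ^ p * d : ℝ) : ℂ) * Complex.I := by
      push_cast
      ring
    rw [h2, h3, Nat.add_sub_cancel, Nat.mul_div_cancel_left p two_pos, if_neg h1, if_pos (by simp)]
    generalize (-1) ^ p * d = q
    generalize Real.cos θ = c, Real.sin θ = s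
    simp

/-- The columns of A + √-1 span the plane over ℝ: a matrix of vectors of the plane is (A + √-1)
times the real matrix of their imaginary parts. -/
theorem isPhase_plane_iff (θ : ℝ) : IsPhase (plane A) θ ↔ phaseSum A θ = 0 := by
  rw [phaseSum_eq_im]
  constructor
  · intro h
    have h1 := h (fun k => planeEquiv A (Pi.single k 1)) fun k => (planeEquiv A _).2
    rw [detForm_apply] at h1
    convert h1 using 4
    ext j k
    apply Complex.ext
    · simp [addI, planeEquiv, Matrix.one_apply, Pi.single_apply, apply_ite Complex.re]
    · simp [addI, planeEquiv, Matrix.one_apply, Pi.single_apply, apply_ite Complex.im]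
  · intro h X hX
    have h1 : (Matrix.of fun j k => X k j) =
        addI A * (Matrix.of fun j k => (X k j).im).map Complex.ofRealHom := by
      ext j k
      rw [addI, add_mul, smul_mul_assoc, one_mul, Matrix.add_apply, Matrix.mul_apply]
      apply Complex.ext
      · simp [hX k j]
      · simp
    have h2 : ((Matrix.of fun j k => (X k j).im).map Complex.ofRealHom).det =
        (((Matrix.of fun j k => (X k j).im).det : ℝ) : ℂ) :=
      (RingHom.map_det Complex.ofRealHom _).symm
    rw [detForm_apply, h1, Matrix.det_mul, h2, ← mul_assoc, Complex.im_mul_ofReal, h, zero_mul]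

end Planes

/-! ### The phase of a nonzero determinant -/

theorem existsUnique_phase {d : ℂ} (hd : d ≠ 0) :
    ∃! θ : ℝ, θ ∈ Ico 0 Real.pi ∧ (Complex.exp (θ * Complex.I) * d).im = 0 := by
  have key : ∀ θ : ℝ, (Complex.exp (θ * Complex.I) * d).im = 0 ↔ Real.sin (θ + d.arg) = 0 := by
    intro θ
    have h : Complex.exp (θ * Complex.I) * d =
        (‖d‖ : ℂ) * Complex.exp ((θ + d.arg : ℝ) * Complex.I) := by
      conv_lhs => rw [← Complex.norm_mul_exp_arg_mul_I d]
      rw [mul_left_comm, ← Complex.exp_add, ← add_mul]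
      push_cast
      rfl
    rw [h, Complex.im_ofReal_mul, Complex.exp_ofReal_mul_I_im]
    simp [hd]
  simp only [key]
  have h1 := Complex.neg_pi_lt_arg d
  have h2 := Complex.arg_le_pi d
  have hex : ∃ θ : ℝ, θ ∈ Ico 0 Real.pi ∧ Real.sin (θ + d.arg) = 0 := by
    rcases le_or_gt d.arg 0 with h | h
    · exact ⟨-d.arg, ⟨by linarith, by linarith⟩, by simp⟩
    · exact ⟨Real.pi - d.arg, ⟨by linarith, by linarith⟩, by simp⟩
  obtain ⟨θ, hθ, hs⟩ := hex
  refine ⟨θ, ⟨hθ, hs⟩, ?_⟩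
  rintro θ' ⟨hθ', hs'⟩
  -- Two solutions in [0, π) differ by a zero of the sine in (-π, π), which is 0.
  have h3 : Real.sin (θ' - θ) = 0 := by
    rw [show θ' - θ = (θ' + d.arg) - (θ + d.arg) by ring, Real.sin_sub, hs, hs', zero_mul,
      mul_zero, sub_zero]
  have h4 := (Real.sin_eq_zero_iff_of_lt_of_lt (by linarith [hθ.2, hθ'.1])
    (by linarith [hθ.1, hθ'.2])).1 h3
  linarith

/-! ### Limits of Lagrangian planes and of their phases -/

section Limits

variable {n : ℕ} {P : ℕ → Submodule ℝ (E n)} {Q : Submodule ℝ (E n)}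

theorem PlanesTendTo.tendsto_starProjection (h : PlanesTendTo P Q) {x : E n} (hx : x ∈ Q) :
    Tendsto (fun k => (P k).starProjection x) atTop (𝓝 x) := by
  have h1 : Tendsto (fun k => (P k).starProjection x) atTop (𝓝 (Q.starProjection x)) :=
    ((ContinuousLinearMap.apply ℝ (E n) x).continuous.tendsto _).comp h
  rwa [Submodule.starProjection_eq_self_iff.2 hx] at h1

/-- Vectors of Q are limits of their projections to the planes P k, where the imaginary part
vanishes. -/
theorem PlanesTendTo.inner_im_eq_zero (h : PlanesTendTo P Q)
    (hP : ∀ k, ∀ x ∈ P k, ∀ y ∈ P k, (inner ℂ x y).im = 0) {x y : E n} (hx : x ∈ Q) (hy : y ∈ Q) :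
    (inner ℂ x y).im = 0 := by
  have h1 := (Complex.continuous_im.tendsto _).comp
    ((h.tendsto_starProjection hx).inner (𝕜 := ℂ) (h.tendsto_starProjection hy))
  refine tendsto_nhds_unique h1 (tendsto_const_nhds.congr fun k => ?_)
  exact (hP k _ (Submodule.starProjection_apply_mem _ _) _
    (Submodule.starProjection_apply_mem _ _)).symm

/-- The phase condition is closed jointly in the phase and the vectors, and the latter are
approximated by their projections. -/
theorem PlanesTendTo.isPhase (h : PlanesTendTo P Q) {s : ℕ → ℝ} {θ : ℝ}
    (hs : ∀ k, IsPhase (P k) (s k)) (hθ : Tendsto s atTop (𝓝 θ)) : IsPhase Q θ := by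
  intro X hX
  have h1 : Tendsto (fun k => detForm n fun l => (P k).starProjection (X l)) atTop
      (𝓝 (detForm n X)) :=
    ((detForm n).cont.tendsto X).comp
      (tendsto_pi_nhds.2 fun l => h.tendsto_starProjection (hX l))
  have h2 : Tendsto (fun k => Complex.exp (s k * Complex.I)) atTop
      (𝓝 (Complex.exp (θ * Complex.I))) := by
    have hc : Continuous fun t : ℝ => Complex.exp (t * Complex.I) := by fun_prop
    exact (hc.tendsto θ).comp hθ
  have h3 := (Complex.continuous_im.tendsto _).comp (h2.mul h1)
  refine tendsto_nhds_unique h3 (tendsto_const_nhds.congr fun k => ?_)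
  exact (hs k _ fun l => Submodule.starProjection_apply_mem _ _).symm

end Limits

end

end CalabiModel

/-! ### The main theorem -/

theorem mainTheorem4 (n : ℕ) [NeZero n] :
    (∃! η : TwoForm n, IsCalabiForm η) ∧ (∃! Φ : TopForm n, IsVolumeForm Φ) ∧
    ∀ (η : TwoForm n) (Φ : TopForm n), IsCalabiForm η → IsVolumeForm Φ →
      (∀ A : Matrix (Fin n) (Fin n) ℝ, A.IsSymm →
        IsLagrangian η (lifted (plane A)) (liftedBoundary (plane A)) ∧
        IsLagrangian η (doubled (plane A)) ∅ ∧
        (∀ θ : ℝ, IsSpecialLagrangian η Φ θ (lifted (plane A)) (liftedBoundary (plane A)) ↔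
          phaseSum A θ = 0) ∧
        (∀ θ : ℝ, IsSpecialLagrangian η Φ θ (doubled (plane A)) ∅ ↔ phaseSum A θ = 0) ∧
        (∃! θ : ℝ, θ ∈ Set.Ico 0 Real.pi ∧ phaseSum A θ = 0)) ∧
      (∀ (A : ℕ → Matrix (Fin n) (Fin n) ℝ) (Q : Submodule ℝ (E n)), (∀ k, (A k).IsSymm) →
        Module.finrank ℝ Q = n → PlanesTendTo (fun k => plane (A k)) Q →
        (∃ θ ∈ Set.Ico 0 (2 * Real.pi),
          IsSpecialLagrangian η Φ θ (lifted Q) (liftedBoundary Q) ∧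
          IsSpecialLagrangian η Φ θ (doubled Q) ∅) ∧
        (∀ (s : ℕ → ℝ) (θ : ℝ), (∀ k, phaseSum (A k) (s k) = 0) →
          Tendsto s atTop (𝓝 θ) →
          IsSpecialLagrangian η Φ θ (lifted Q) (liftedBoundary Q) ∧
          IsSpecialLagrangian η Φ θ (doubled Q) ∅)) := by
  refine ⟨existsUnique_isCalabiForm n, existsUnique_isVolumeForm n, fun η Φ hη hΦ => ⟨?_, ?_⟩⟩
  · intro A hA
    obtain ⟨M, hM⟩ := exists_unitary (finrank_plane A)
      fun x hx y hy => inner_im_eq_zero_of_plane hA hx hy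
    obtain ⟨h1, h2, h3, h4⟩ := lifts_of_unitary hη hΦ M hM
    refine ⟨h1, h2, fun θ => (h3 θ).trans (isPhase_plane_iff A θ),
      fun θ => (h4 θ).trans (isPhase_plane_iff A θ), ?_⟩
    have hd := existsUnique_phase (LinearEquiv.isUnit_det' M.toLinearEquiv).ne_zero
    have hiff : ∀ θ : ℝ, phaseSum A θ = 0 ↔ _ := fun θ =>
      (isPhase_plane_iff A θ).symm.trans (isPhase_iff (M := M.toContinuousLinearEquiv) hM θ)
    simp only [hiff]
    exact hd
  · intro A Q hA hQ hlim
    obtain ⟨M, hM⟩ := exists_unitary hQ fun x hx y hy =>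
      hlim.inner_im_eq_zero (fun k x hx y hy => inner_im_eq_zero_of_plane (hA k) hx hy) hx hy
    obtain ⟨-, -, h3, h4⟩ := lifts_of_unitary hη hΦ M hM
    refine ⟨?_, fun s θ hs hθ => ?_⟩
    -- The phase comes from det M for the limit plane itself; no convergence of phases is needed
    -- here.
    · obtain ⟨θ, ⟨hθ, hp⟩, -⟩ := existsUnique_phase
        (LinearEquiv.isUnit_det' M.toLinearEquiv).ne_zero
      have hp' := (isPhase_iff (M := M.toContinuousLinearEquiv) hM θ).2 hp
      exact ⟨θ, ⟨hθ.1, by linarith [hθ.2, Real.pi_pos]⟩, (h3 θ).2 hp', (h4 θ).2 hp'⟩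
    · have hp := hlim.isPhase (fun k => (isPhase_plane_iff (A k) (s k)).2 (hs k)) hθ
      exact ⟨(h3 θ).2 hp, (h4 θ).2 hp⟩
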